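/- Conventions. $\mathcal H$ is a complex Hilbert space and $\mathcal A$ a complex (possibly nonunital) $*$-algebra represented on $\mathcal H$ by bounded operators (the representation is suppressed). Products, sums and powers of unbounded operators have their natural domains. For a bounded operator $a$ and an unbounded operator $T$, "$[T,a]$ extends to a bounded operator" means that $a$ maps $\operatorname{dom}T$ into itself and $Ta-aT$, defined on $\operatorname{dom}T$, is the restriction of a bounded operator on $\mathcal H$. $(\mathcal A,\mathcal H,\mathcal D)$ is a spectral triple if $\mathcal D$ is a densely defined self-adjoint operator on $\mathcal H$ such that, for all $a\in\mathcal A$, $[\mathcal D,a]$ extends to a bounded operator and $a(1+\mathcal D^2)^{-1/2}$ is compact. For a densely defined closed operator $\mathcal D$ put $$\langle\mathcal D\rangle^2=\tfrac12(\mathcal D\mathcal D^*+\mathcal D^*\mathcal D)\ \text{ on } \operatorname{dom}\mathcal D\mathcal D^*\cap\operatorname{dom}\mathcal D^*\mathcal D,\qquad \mathcal R_{\mathcal D}=\tfrac i2(\mathcal D^2-\mathcal D^{*2})\ \text{ on } \operatorname{dom}\mathcal D^2\cap\operatorname{dom}\mathcal D^{*2}.$$ $(\mathcal A,\mathcal H,\mathcal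 D)$ is a pseudo-Riemannian spectral triple if $\mathcal D$ is a densely defined closed operator such that the following hold. 1) $\operatorname{dom}\mathcal D^*\mathcal D\cap\operatorname{dom}\mathcal D\mathcal D^*$ is dense in $\mathcal H$ and $\langle\mathcal D\rangle^2$ is essentially self-adjoint on this domain. Let $N$ be its (positive, self-adjoint) closure, $\mathcal H_\infty=\bigcap_{k\ge0}\operatorname{dom}N^{k}$ $(=\bigcap_{k\ge 0}\operatorname{dom}\langle\mathcal D\rangle^k$ with $\langle\mathcal D\rangle=N^{1/2})$ and $\Lambda=(1+N)^{1/2}$. 2a) The operators $\langle\mathcal D\rangle^2$ and $\mathcal R_{\mathcal D}$ are defined on $\mathcal H_\infty$, $\mathcal R_{\mathcal D}$ maps $\mathcal H_\infty$ into $\mathcal H_\infty$, and $[\langle\mathcal D\rangle^2,\mathcal R_{\mathcal D}]\in\mathrm{OP}^2(\langle\mathcal D\rangle)$, that is, on $\mathcal H_\infty$ this commutator equals $\Lambda^2B$ for some bounded operator $B\in\bigcap_n\operatorname{dom}\delta^n$. Here $\delta(B)$ is the bounded extension of $[\Lambda,B]$, $\operatorname{dom}\delta$ is the set of bounded $B$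 for which $[\Lambda,B]$ extends to a bounded operator, and $\operatorname{dom}\delta^{n+1}=\{B\in\operatorname{dom}\delta:\delta(B)\in\operatorname{dom}\delta^n\}$. 2b) For all $a\in\mathcal A$ the operator $a\mathcal R_{\mathcal D}(1+N)^{-1}$, defined on $\mathcal H_\infty$, extends to a compact operator on $\mathcal H$. 3) For all $a\in\mathcal A$, $[\mathcal D,a]$ and $[\mathcal D^*,a]$ extend to bounded operators. 4) $a(1+N)^{-1/2}$ is compact for all $a\in\mathcal A$. **Theorem.** Let $(\mathcal A,\mathcal H,\mathcal D)$ be a pseudo-Riemannian spectral triple and let $$\mathcal D_E:=\tfrac12(\mathcal D+\mathcal D^*)+\tfrac i2(\mathcal D-\mathcal D^*)=\tfrac{e^{i\pi/4}}{\sqrt2}(\mathcal D-i\mathcal D^*)\quad\text{on } \operatorname{dom}\mathcal D\cap\operatorname{dom}\mathcal D^* .$$ Then $\mathcal D_E$ is essentially self-adjoint, and, writing $\mathcal D_E$ also for its closure, $(\mathcal A,\mathcal H,\mathcal D_E)$ is a spectral triple: $\mathcal D_E$ is self-adjoint, $[\mathcal D_E,a]$ extends to a bounded operator, and $a(1+\mathcal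 D_E^2)^{-1/2}$ is compact, for every $a\in\mathcal A$. -/

import Mathlib

open scoped LinearPMap

noncomputable section

namespace WickRotation

section Operators

variable {H : Type*} [NormedAddCommGroup H] [InnerProductSpace ℂ H]

/-! ### Products and powers of unbounded operators -/

/-- The product `S T` of two unbounded operators on its natural domain
`{x ∈ dom T | T x ∈ dom S}`. -/
def mulOp (S T : H →ₗ.[ℂ] H) : H →ₗ.[ℂ] H where
  domain :=
    { carrier := {x | ∃ h : x ∈ T.domain, T ⟨x, h⟩ ∈ S.domain}
      zero_mem' := ⟨T.domain.zero_mem, by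
        have h0 : T ⟨0, T.domain.zero_mem⟩ = 0 := T.map_zero
        rw [h0]; exact S.domain.zero_mem⟩
      add_mem' := by
        rintro x y ⟨hx, hx'⟩ ⟨hy, hy'⟩
        refine ⟨T.domain.add_mem hx hy, ?_⟩
        have h0 : T ⟨x + y, T.domain.add_mem hx hy⟩ = T ⟨x, hx⟩ + T ⟨y, hy⟩ :=
          T.map_add ⟨x, hx⟩ ⟨y, hy⟩
        rw [h0]; exact S.domain.add_mem hx' hy'
      smul_mem' := by
        rintro c x ⟨hx, hx'⟩
        refine ⟨T.domain.smul_mem c hx, ?_⟩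
        have h0 : T ⟨c • x, T.domain.smul_mem c hx⟩ = c • T ⟨x, hx⟩ :=
          T.map_smul c ⟨x, hx⟩
        rw [h0]; exact S.domain.smul_mem c hx' }
  toFun :=
    { toFun := fun x => S ⟨T ⟨x.1, x.2.choose⟩, x.2.choose_spec⟩
      map_add' := by
        intro x y
        rw [← S.map_add]
        congr 1
        exact Subtype.ext (T.map_add ⟨x.1, x.2.choose⟩ ⟨y.1, y.2.choose⟩)
      map_smul' := by
        intro c x
        rw [RingHom.id_apply, ← S.map_smul]
        congr 1
        exact Subtype.ext (T.map_smul c ⟨x.1, x.2.choose⟩) }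

theorem mem_mulOp_domain {S T : H →ₗ.[ℂ] H} {x : H} :
    x ∈ (mulOp S T).domain ↔ ∃ h : x ∈ T.domain, T ⟨x, h⟩ ∈ S.domain := Iff.rfl

theorem mulOp_apply {S T : H →ₗ.[ℂ] H} {x : H} (hx : x ∈ (mulOp S T).domain)
    (hT : x ∈ T.domain) (hS : T ⟨x, hT⟩ ∈ S.domain) :
    mulOp S T ⟨x, hx⟩ = S ⟨T ⟨x, hT⟩, hS⟩ := rfl

/-- The powers `T ^ k` of an unbounded operator, on their natural domains. -/
def powOp (T : H →ₗ.[ℂ] H) : ℕ → (H →ₗ.[ℂ] H)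
  | 0 => (LinearMap.id : H →ₗ[ℂ] H).toPMap ⊤
  | k + 1 => mulOp T (powOp T k)

/-- The space `⋂ₖ dom T ^ k`. For a positive self-adjoint `T` it is also `⋂ₖ dom T ^ (k / 2)`. -/
def smoothDomain (T : H →ₗ.[ℂ] H) : Submodule ℂ H := ⨅ k : ℕ, (powOp T k).domain

/-- The bounded operator `a` maps `dom T` into itself, and `[T, a] = T a - a T`, which is then
defined on `dom T`, extends to the bounded operator `c`. -/
def IsBoundedCommutator (T : H →ₗ.[ℂ] H) (a c : H →L[ℂ] H) : Prop :=
  ∀ x : T.domain, ∃ h : a x ∈ T.domain, T ⟨a x, h⟩ - a (T x) = c x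

/-! ### `(1 + T)⁻¹` and `(1 + T)^(-1/2)` -/

/-- The bounded operator `S` is the (two-sided) inverse of `1 + T : dom T → H`. -/
def IsOneAddInv (T : H →ₗ.[ℂ] H) (S : H →L[ℂ] H) : Prop :=
  (∀ x : H, ∃ h : S x ∈ T.domain, S x + T ⟨S x, h⟩ = x) ∧ ∀ x : T.domain, S (x + T x) = x

/-- `S = (1 + T)^(-1/2)`: `S` is a positive bounded operator whose square is `(1 + T)⁻¹`. -/
def IsOneAddInvSqrt (T : H →ₗ.[ℂ] H) (S : H →L[ℂ] H) : Prop :=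
  S.IsPositive ∧ IsOneAddInv T (S ∘L S)

open scoped Classical in
/-- The bounded operator `(1 + T)^(-1/2)`. It exists and is unique when `T` is self-adjoint and
positive, see `existsUnique_isOneAddInvSqrt`, and when `T = D ^ 2` with `D` self-adjoint, see
`existsUnique_isOneAddInvSqrt_sq`. -/
def oneAddInvSqrt (T : H →ₗ.[ℂ] H) : H →L[ℂ] H :=
  if h : ∃ S, IsOneAddInvSqrt T S then h.choose else 0

/-- The bounded operator `(1 + T)⁻¹`, the square of `(1 + T)^(-1/2)`. -/
def oneAddInv (T : H →ₗ.[ℂ] H) : H →L[ℂ] H := oneAddInvSqrt T ∘L oneAddInvSqrt T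

/-- The unbounded operator `(1 + T)^(1/2)`, the inverse of `(1 + T)^(-1/2)`; its domain is the
range of `(1 + T)^(-1/2)`. -/
def oneAddSqrt (T : H →ₗ.[ℂ] H) : H →ₗ.[ℂ] H :=
  ((oneAddInvSqrt T : H →ₗ[ℂ] H).toPMap ⊤).inverse

/-! ### Pseudodifferential operators -/

/-- `dom δ ^ n`, where `δ(B) = [Λ, B]` and `dom δ` consists of the bounded operators `B` that
preserve `dom Λ` and for which `[Λ, B]` extends to a bounded operator. -/
def domDelta (Λ : H →ₗ.[ℂ] H) : ℕ → Set (H →L[ℂ] H)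
  | 0 => Set.univ
  | n + 1 => {B | ∃ B' : H →L[ℂ] H, IsBoundedCommutator Λ B B' ∧ B' ∈ domDelta Λ n}

/-- For a positive self-adjoint operator `N = ⟨D⟩ ^ 2` and `Λ = (1 + ⟨D⟩ ^ 2)^(1/2)`, the operator
`X`, regarded as an operator on `⋂ₖ dom N ^ k` (on which it has to be defined), belongs to
`OP ^ m (⟨D⟩) = Λ ^ m (⋂ₙ dom δ ^ n)`. -/
def IsOP (N : H →ₗ.[ℂ] H) (m : ℕ) (X : H →ₗ.[ℂ] H) : Prop :=
  ∃ B ∈ ⋂ n : ℕ, domDelta (oneAddSqrt N) n, ∀ x ∈ smoothDomain N,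
    ∃ (hx : x ∈ X.domain) (hB : B x ∈ (powOp (oneAddSqrt N) m).domain),
      X ⟨x, hx⟩ = powOp (oneAddSqrt N) m ⟨B x, hB⟩

/-! ### Existence and uniqueness of `(1 + T)^(-1/2)` -/

theorem isOneAddInv_unique {T : H →ₗ.[ℂ] H} {S S' : H →L[ℂ] H} (hS : IsOneAddInv T S)
    (hS' : IsOneAddInv T S') : S = S' := by
  ext x
  obtain ⟨h, hx⟩ := hS.1 x
  have := hS'.2 ⟨S x, h⟩
  simp only [hx] at this
  exact this.symm

variable [CompleteSpace H]

theorem isOneAddInvSqrt_unique {T : H →ₗ.[ℂ] H} {S S' : H →L[ℂ] H} (hS : IsOneAddInvSqrt T S)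
    (hS' : IsOneAddInvSqrt T S') : S = S' := by
  have h : S * S = S' * S' := isOneAddInv_unique hS.2 hS'.2
  have h1 : (0 : H →L[ℂ] H) ≤ S := (ContinuousLinearMap.nonneg_iff_isPositive S).2 hS.1
  have h2 : (0 : H →L[ℂ] H) ≤ S' := (ContinuousLinearMap.nonneg_iff_isPositive S').2 hS'.1
  rw [← CFC.sqrt_mul_self S h1, h, CFC.sqrt_mul_self S' h2]

theorem oneAddInvSqrt_eq {T : H →ₗ.[ℂ] H} {S : H →L[ℂ] H} (hS : IsOneAddInvSqrt T S) :
    oneAddInvSqrt T = S := by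
  have h : ∃ S, IsOneAddInvSqrt T S := ⟨S, hS⟩
  rw [oneAddInvSqrt, dif_pos h]
  exact isOneAddInvSqrt_unique h.choose_spec hS

/-- If `1 + T` is onto, `T` is symmetric and positive, then `(1 + T)^(-1/2)` exists. -/
theorem exists_isOneAddInvSqrt_of_surjective {T : H →ₗ.[ℂ] H} (hsymm : T.IsFormalAdjoint T)
    (hpos : ∀ x : T.domain, 0 ≤ (inner ℂ (x : H) (T x)).re)
    (hsurj : ∀ y : H, ∃ x : T.domain, (x : H) + T x = y) :
    ∃ S : H →L[ℂ] H, IsOneAddInvSqrt T S := by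
  have hbound : ∀ x : T.domain, ‖(x : H)‖ ≤ ‖(x : H) + T x‖ := by
    intro x
    have h1 : ‖(x : H)‖ ^ 2 ≤ ‖(x : H)‖ * ‖(x : H) + T x‖ := by
      refine le_trans ?_ (re_inner_le_norm (𝕜 := ℂ) (x : H) ((x : H) + T x))
      rw [inner_add_right, map_add, inner_self_eq_norm_sq]
      exact le_add_of_nonneg_right (hpos x)
    by_cases h0 : ‖(x : H)‖ = 0
    · rw [h0]; exact norm_nonneg _
    · have : 0 < ‖(x : H)‖ := lt_of_le_of_ne (norm_nonneg _) (Ne.symm h0)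
      nlinarith
  have hinj : ∀ x x' : T.domain, (x : H) + T x = x' + T x' → x = x' := by
    intro x x' h
    have h1 := hbound (x - x')
    have h2 : ((x - x' : T.domain) : H) + T (x - x') = 0 := by
      rw [LinearPMap.map_sub, AddSubgroupClass.coe_sub]
      have : (x : H) - x' + (T x - T x') = (x + T x) - (x' + T x') := by abel
      rw [this, h, sub_self]
    rw [h2, norm_zero] at h1
    have h3 := norm_le_zero_iff.1 h1
    exact sub_eq_zero.1 (Subtype.ext h3)
  choose g hg using hsurj
  have hg' : ∀ x : T.domain, g (x + T x) = x := fun x => hinj _ _ (hg _)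
  let R0 : H →ₗ[ℂ] H :=
    { toFun := fun y => (g y : H)
      map_add' := by
        intro y z
        have : g (y + z) = g y + g z := by
          apply hinj
          rw [hg, LinearPMap.map_add, Submodule.coe_add]
          nth_rewrite 1 [← hg y, ← hg z]
          abel
        rw [this, Submodule.coe_add]
      map_smul' := by
        intro c y
        have : g (c • y) = c • g y := by
          apply hinj
          rw [hg, LinearPMap.map_smul, Submodule.coe_smul, ← smul_add, hg]
        rw [this, Submodule.coe_smul, RingHom.id_apply] }
  let R : H →L[ℂ] H := R0.mkContinuous 1 (by
    intro y
    rw [one_mul]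
    have := hbound (g y)
    rwa [hg] at this)
  have hR : ∀ y, R y = g y := fun _ => rfl
  have hRpos : R.IsPositive := by
    constructor
    · intro y z
      change inner ℂ (g y : H) z = inner ℂ y (g z : H)
      conv_lhs => rw [← hg z]
      conv_rhs => rw [← hg y]
      rw [inner_add_left, inner_add_right, hsymm]
    · intro y
      change 0 ≤ (inner ℂ (R y) y).re
      rw [hR]
      conv_rhs => rw [← hg y]
      rw [hg' (g y), inner_add_right, Complex.add_re]
      exact add_nonneg (inner_self_nonneg (𝕜 := ℂ)) (hpos _)
  have hRinv : IsOneAddInv T R := by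
    refine ⟨fun x => ⟨(g x).2, hg x⟩, fun x => ?_⟩
    rw [hR, hg']
  have hR0 : (0 : H →L[ℂ] H) ≤ R := (ContinuousLinearMap.nonneg_iff_isPositive R).2 hRpos
  refine ⟨CFC.sqrt R, (ContinuousLinearMap.nonneg_iff_isPositive _).1 (CFC.sqrt_nonneg R), ?_⟩
  have : CFC.sqrt R ∘L CFC.sqrt R = R := CFC.sqrt_mul_sqrt_self R hR0
  rw [this]
  exact hRinv

/-- A closed operator `c + T` that is bounded below and has dense range is onto. -/
theorem surjective_of_bound {T : H →ₗ.[ℂ] H} (hT : IsSelfAdjoint T) (c : ℂ)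
    (hb : ∀ x : T.domain, ‖(x : H)‖ ≤ ‖c • (x : H) + T x‖)
    (hker : ∀ x : T.domain, T x = -(starRingEnd ℂ c) • (x : H) → (x : H) = 0) (y : H) :
    ∃ x : T.domain, c • (x : H) + T x = y := by
  have hadj : T† = T := hT
  have hd : Dense (T.domain : Set H) := hT.dense_domain
  have hclosed : IsClosed (T.graph : Set (H × H)) := by
    have := LinearPMap.adjoint_isClosed hd
    rw [hadj] at this
    exact this
  have : CompleteSpace T.graph := hclosed.completeSpace_coe
  let f : T.graph →L[ℂ] H :=
    (c • ContinuousLinearMap.fst ℂ H H + ContinuousLinearMap.snd ℂ H H) ∘L T.graph.subtypeL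
  have hf : ∀ p : T.graph, ‖p‖ ≤ (2 + ‖c‖) * ‖f p‖ := by
    rintro ⟨⟨x, z⟩, hp⟩
    obtain ⟨hx, rfl⟩ : ∃ hx : x ∈ T.domain, T ⟨x, hx⟩ = z := by
      rw [LinearPMap.mem_graph_iff] at hp
      obtain ⟨u, hu, hu'⟩ := hp
      simp only at hu hu'
      subst hu
      exact ⟨u.2, hu'⟩
    have h1 := hb ⟨x, hx⟩
    have h2 : ‖T ⟨x, hx⟩‖ ≤ ‖c • x + T ⟨x, hx⟩‖ + ‖c‖ * ‖x‖ := by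
      rw [← norm_smul]
      have : T ⟨x, hx⟩ = (c • x + T ⟨x, hx⟩) - c • x := by abel
      conv_lhs => rw [this]
      exact norm_sub_le _ _
    change max ‖x‖ ‖T ⟨x, hx⟩‖ ≤ (2 + ‖c‖) * ‖c • x + T ⟨x, hx⟩‖
    simp only at h1
    have h3 := norm_nonneg c
    have h4 := norm_nonneg (c • x + T ⟨x, hx⟩)
    have h5 := mul_le_mul_of_nonneg_left h1 h3
    have h6 := mul_nonneg h3 h4
    refine max_le ?_ ?_ <;> nlinarith
  have hanti : AntilipschitzWith (2 + ‖c‖₊) f := by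
    refine ContinuousLinearMap.antilipschitz_of_bound f ?_
    intro p
    simpa using hf p
  have hrc : IsClosed (Set.range f) := hanti.isClosed_range f.uniformContinuous
  have hrange : LinearMap.range (f : T.graph →ₗ[ℂ] H) = ⊤ := by
    have hc : IsClosed ((LinearMap.range (f : T.graph →ₗ[ℂ] H) : Submodule ℂ H) : Set H) := hrc
    rw [← hc.submodule_topologicalClosure_eq, Submodule.topologicalClosure_eq_top_iff,
      Submodule.eq_bot_iff]
    intro w hw
    rw [Submodule.mem_orthogonal'] at hw
    have hw' : ∀ x : T.domain, inner ℂ (-(starRingEnd ℂ c) • w) (x : H) = inner ℂ w (T x) := by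
      intro x
      have h1 := hw (c • (x : H) + T x)
        ⟨⟨((x : H), T x), LinearPMap.mem_graph T x⟩, rfl⟩
      rw [inner_add_right, inner_smul_right] at h1
      rw [inner_smul_left, map_neg, Complex.conj_conj]
      linear_combination -h1
    have hmem : w ∈ T†.domain := LinearPMap.mem_adjoint_domain_of_exists _ ⟨_, hw'⟩
    have happ : T† ⟨w, hmem⟩ = -(starRingEnd ℂ c) • w := LinearPMap.adjoint_apply_eq hd _ hw'
    have key : ∀ (A : H →ₗ.[ℂ] H), A = T → ∀ h : w ∈ A.domain,
        A ⟨w, h⟩ = -(starRingEnd ℂ c) • w → w = 0 := by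
      rintro A rfl h h'
      exact hker ⟨w, h⟩ h'
    exact key _ hadj hmem happ
  obtain ⟨⟨⟨x, z⟩, hp⟩, hxy⟩ : y ∈ LinearMap.range (f : T.graph →ₗ[ℂ] H) := by
    rw [hrange]; trivial
  rw [LinearPMap.mem_graph_iff] at hp
  obtain ⟨u, hu, hu'⟩ := hp
  simp only at hu hu'
  subst hu hu'
  exact ⟨u, hxy⟩

theorem isFormalAdjoint_self {T : H →ₗ.[ℂ] H} (hT : IsSelfAdjoint T) : T.IsFormalAdjoint T := by
  have h := LinearPMap.adjoint_isFormalAdjoint hT.dense_domain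
  have hadj : T† = T := hT
  rwa [hadj] at h

/-- For a positive self-adjoint operator `T` the bounded operator `(1 + T)^(-1/2)` exists and is
unique. -/
theorem existsUnique_isOneAddInvSqrt {T : H →ₗ.[ℂ] H} (hT : IsSelfAdjoint T)
    (hpos : ∀ x : T.domain, 0 ≤ (inner ℂ (x : H) (T x)).re) :
    ∃! S : H →L[ℂ] H, IsOneAddInvSqrt T S := by
  refine existsUnique_of_exists_of_unique ?_ fun _ _ h h' => isOneAddInvSqrt_unique h h'
  refine exists_isOneAddInvSqrt_of_surjective (isFormalAdjoint_self hT) hpos fun y => ?_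
  have hs := surjective_of_bound hT 1 ?_ ?_ y
  · simpa only [one_smul] using hs
  · intro x
    rw [one_smul]
    have h1 : ‖(x : H)‖ ^ 2 ≤ ‖(x : H)‖ * ‖(x : H) + T x‖ := by
      refine le_trans ?_ (re_inner_le_norm (𝕜 := ℂ) (x : H) ((x : H) + T x))
      rw [inner_add_right, map_add, inner_self_eq_norm_sq]
      exact le_add_of_nonneg_right (hpos x)
    by_cases h0 : ‖(x : H)‖ = 0
    · rw [h0]; exact norm_nonneg _
    · have : 0 < ‖(x : H)‖ := lt_of_le_of_ne (norm_nonneg _) (Ne.symm h0)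
      nlinarith
  · intro x hx
    have h1 := hpos x
    rw [hx, map_one, neg_smul, one_smul, inner_neg_right, Complex.neg_re] at h1
    have h2 : (inner ℂ (x : H) (x : H)).re = ‖(x : H)‖ ^ 2 := inner_self_eq_norm_sq (𝕜 := ℂ) _
    rw [h2] at h1
    have h3 : ‖(x : H)‖ ^ 2 = 0 := le_antisymm (by linarith) (sq_nonneg _)
    exact norm_eq_zero.1 (pow_eq_zero_iff two_ne_zero |>.1 h3)

/-- For a self-adjoint operator `D` the bounded operator `(1 + D ^ 2)^(-1/2)` exists and is
unique. -/
theorem existsUnique_isOneAddInvSqrt_sq {D : H →ₗ.[ℂ] H} (hD : IsSelfAdjoint D) :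
    ∃! S : H →L[ℂ] H, IsOneAddInvSqrt (mulOp D D) S := by
  refine existsUnique_of_exists_of_unique ?_ fun _ _ h h' => isOneAddInvSqrt_unique h h'
  have hfa := isFormalAdjoint_self hD
  have him : ∀ x : D.domain, (inner ℂ (x : H) (D x)).im = 0 := by
    intro x
    have h1 := hfa x x
    rw [← inner_conj_symm] at h1
    have h2 := congrArg Complex.im h1
    rw [Complex.conj_im] at h2
    linarith
  have hnorm : ∀ (c : ℂ), c.re = 0 → c.im ^ 2 = 1 → ∀ x : D.domain,
      ‖(x : H)‖ ≤ ‖c • (x : H) + D x‖ := by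
    intro c hc hc' x
    have h1 : ‖c • (x : H) + D x‖ ^ 2
        = ‖c • (x : H)‖ ^ 2 + 2 * (inner ℂ (c • (x : H)) (D x)).re + ‖D x‖ ^ 2 :=
      norm_add_sq (𝕜 := ℂ) _ _
    have h2 : (inner ℂ (c • (x : H)) (D x)).re = 0 := by
      rw [inner_smul_left, Complex.mul_re, him, Complex.conj_re, hc]
      ring
    have h3 : ‖c‖ = 1 := by
      have h4 : ‖c‖ ^ 2 = 1 := by
        rw [← Complex.normSq_eq_norm_sq, Complex.normSq_apply, hc]
        nlinarith
      nlinarith [norm_nonneg c]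
    rw [h2, norm_smul, h3] at h1
    nlinarith [norm_nonneg (x : H), norm_nonneg (c • (x : H) + D x), sq_nonneg ‖D x‖]
  have hker : ∀ (c : ℂ), c.re = 0 → c.im ^ 2 = 1 → ∀ x : D.domain,
      D x = -(starRingEnd ℂ c) • (x : H) → (x : H) = 0 := by
    intro c hc hc' x hx
    have h1 := hnorm (starRingEnd ℂ c) (by simpa using hc) (by simpa using hc') x
    rw [hx, neg_smul, add_neg_cancel, norm_zero] at h1
    exact norm_le_zero_iff.1 h1
  refine exists_isOneAddInvSqrt_of_surjective ?_ ?_ ?_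
  · rintro ⟨x, hx, hx'⟩ ⟨y, hy, hy'⟩
    change inner ℂ (D ⟨D ⟨x, hx⟩, hx'⟩) y = inner ℂ x (D ⟨D ⟨y, hy⟩, hy'⟩)
    rw [hfa ⟨_, hx'⟩ ⟨y, hy⟩, ← hfa ⟨x, hx⟩ ⟨_, hy'⟩]
  · rintro ⟨x, hx, hx'⟩
    change 0 ≤ (inner ℂ x (D ⟨D ⟨x, hx⟩, hx'⟩)).re
    rw [← hfa ⟨x, hx⟩ ⟨_, hx'⟩]
    exact inner_self_nonneg (𝕜 := ℂ)
  · intro y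
    obtain ⟨u, hu⟩ := surjective_of_bound hD Complex.I
      (hnorm _ (by simp) (by simp)) (hker _ (by simp) (by simp)) y
    obtain ⟨x, hx⟩ := surjective_of_bound hD (-Complex.I)
      (hnorm _ (by simp) (by simp)) (hker _ (by simp) (by simp)) (u : H)
    have hDx : D x = u + Complex.I • (x : H) := by
      rw [← hx, neg_smul]; abel
    have hmem : D x ∈ D.domain := by
      rw [hDx]; exact D.domain.add_mem u.2 (D.domain.smul_mem _ x.2)
    refine ⟨⟨x, x.2, hmem⟩, ?_⟩
    have h1 : D ⟨D x, hmem⟩ = D u + Complex.I • D x := by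
      rw [← D.map_smul, ← D.map_add]
      congr 1
      exact Subtype.ext hDx
    change (x : H) + D ⟨D x, hmem⟩ = y
    rw [h1, hDx, ← hu, smul_add, smul_smul, Complex.I_mul_I, neg_smul, one_smul]
    abel

/-! ### Spectral triples -/

/-- `⟨D⟩ ^ 2 = ½ (D D* + D* D)`, on `dom D D* ∩ dom D* D`. -/
def absSq (D : H →ₗ.[ℂ] H) : H →ₗ.[ℂ] H :=
  (1 / 2 : ℂ) • (mulOp D D† + mulOp D† D)

/-- `R_D = (i/2) (D ^ 2 - D* ^ 2)`, on `dom D ^ 2 ∩ dom D* ^ 2`. -/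
def remainder (D : H →ₗ.[ℂ] H) : H →ₗ.[ℂ] H :=
  (Complex.I / 2) • (mulOp D D - mulOp D† D†)

/-- The Wick rotation `½ (D + D*) + (i/2) (D - D*)`, on its initial domain `dom D ∩ dom D*`. -/
def wickRotation (D : H →ₗ.[ℂ] H) : H →ₗ.[ℂ] H :=
  (1 / 2 : ℂ) • (D + D†) + (Complex.I / 2) • (D - D†)

/-- The operator is closable and its closure is self-adjoint. -/
def IsEssentiallySelfAdjoint (T : H →ₗ.[ℂ] H) : Prop :=
  T.IsClosable ∧ IsSelfAdjoint T.closure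

variable {A : Type*} [NonUnitalRing A] [StarRing A] [Module ℂ A]

/-- `(A, H, D)` is a spectral triple, where the `*`-algebra `A` is represented on `H` by `π`. -/
structure IsSpectralTriple (π : A →⋆ₙₐ[ℂ] (H →L[ℂ] H)) (D : H →ₗ.[ℂ] H) : Prop where
  dense_domain : Dense (D.domain : Set H)
  isSelfAdjoint : IsSelfAdjoint D
  bounded_commutator : ∀ a : A, ∃ c : H →L[ℂ] H, IsBoundedCommutator D (π a) c
  /-- `a (1 + D ^ 2)^(-1/2)` is compact. -/
  compact_resolvent : ∀ a : A, IsCompactOperator (π a ∘L oneAddInvSqrt (mulOp D D))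

/-- `(A, H, D)` is a pseudo-Riemannian spectral triple, where the `*`-algebra `A` is represented on
`H` by `π`. The positive self-adjoint closure of `⟨D⟩ ^ 2` is `(absSq D).closure`, and
`H_∞ = ⋂ₖ dom ⟨D⟩ ^ k` is `smoothDomain (absSq D).closure`. -/
structure IsPseudoRiemannianSpectralTriple (π : A →⋆ₙₐ[ℂ] (H →L[ℂ] H)) (D : H →ₗ.[ℂ] H) :
    Prop where
  dense_domain : Dense (D.domain : Set H)
  isClosed : D.IsClosed
  /-- `dom D* D ∩ dom D D*` is dense. -/
  dense_absSq : Dense ((absSq D).domain : Set H)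
  /-- `⟨D⟩ ^ 2` is essentially self-adjoint on this domain. -/
  absSq_essentiallySelfAdjoint : IsEssentiallySelfAdjoint (absSq D)
  /-- `⟨D⟩ ^ 2 = ½ (D D* + D* D)` is defined on `H_∞`. -/
  smoothDomain_le : smoothDomain (absSq D).closure ≤ (absSq D).domain
  /-- `R_D : H_∞ → H_∞`. -/
  remainder_mapsTo : ∀ x ∈ smoothDomain (absSq D).closure,
    ∃ h : x ∈ (remainder D).domain, remainder D ⟨x, h⟩ ∈ smoothDomain (absSq D).closure
  /-- `[⟨D⟩ ^ 2, R_D] ∈ OP ^ 2 (⟨D⟩)`. -/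
  commutator_remainder : IsOP (absSq D).closure 2
    (mulOp (absSq D) (remainder D) - mulOp (remainder D) (absSq D))
  /-- `a R_D (1 + ⟨D⟩ ^ 2)⁻¹`, which is defined on `H_∞`, extends to a compact operator. -/
  compact_remainder : ∀ a : A, ∃ K : H →L[ℂ] H, IsCompactOperator K ∧
    ∀ x ∈ smoothDomain (absSq D).closure,
      ∀ h : oneAddInv (absSq D).closure x ∈ (remainder D).domain,
        K x = π a (remainder D ⟨oneAddInv (absSq D).closure x, h⟩)
  bounded_commutator : ∀ a : A, ∃ c : H →L[ℂ] H, IsBoundedCommutator D (π a) c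
  bounded_commutator_adjoint : ∀ a : A, ∃ c : H →L[ℂ] H, IsBoundedCommutator D† (π a) c
  /-- `a (1 + ⟨D⟩ ^ 2)^(-1/2)` is compact. -/
  compact_resolvent : ∀ a : A,
    IsCompactOperator (π a ∘L oneAddInvSqrt (absSq D).closure)

end Operators

end WickRotation

end

/-!
Write `N` for the closure of `⟨D⟩ ^ 2`, `P = (1 + N)⁻¹`, `W = P ^ (1/2)`, `R = R_D`, and `V` for the
smooth vectors of `N`. A computation gives `D_E ^ 2 = N + R` on `V`.

*Essential self-adjointness.* It suffices that the range of `N + R - i κ` on `V` is dense for all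
large real `κ`, because `N + R - c ^ 2` factors through `D_E - c`
(`exists_wickRotation_sub_sq_graph`, `isEssentiallySelfAdjoint_of_range`). The density is a form of
Nelson's commutator theorem (`eq_zero_of_commutator`). As `R` is form bounded by `N`, the operator
`P R P` is bounded, and the condition `[N, R] = Λ ^ 2 B` reads `R P = P R + B P`, so that
`R P ^ 2 = P R P + B P ^ 2` is bounded too. If `ψ` is orthogonal to the range, the test vectors
`P ^ 2 v`, `v ∈ V`, can be extended by continuity to `P ^ 2 ψ`. The imaginary part of the resulting
equation contains only `κ ‖P ψ‖ ^ 2` and the term from `B P ^ 2`. Since `B ∈ dom δ ^ 2`, one has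
`B P = P C` with `C` bounded, so this term is at most `‖C‖ ‖P ψ‖ ^ 2`, whence `ψ = 0` for
`|κ| > ‖C‖`. That `V` is dense follows from `V = ⋂ₖ ran P ^ k` and the continuous functional
calculus (`dense_rangePowers`).

*Compact resolvent.* Put `G = (1 + D_E ^ 2)⁻¹` and `c = [D_E, a]`. Compactness of `a† R P` says that
`P (1 + D_E ^ 2) a` equals `a` up to a compact operator. Commuting `a` past `D_E ^ 2` in
`P (1 + D_E ^ 2) a G` produces `P a`, `P D_E c G` and `P [D_E, a†]† D_E G`, up to sign, where
`P D_E = W (W D_E)` with `W D_E` bounded (`exists_comp_oneAddInv_eq`). As `a† W` is compact,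
multiplication by `a†` from the left shows that `a† a G` is compact. The extra factor `a†` is
necessary for this step, since the commutators need not be relatively compact; it is then removed by
`‖X v‖ ^ 2 ≤ ‖X† X v‖ ‖v‖`, which also passes from `G` to `G ^ (1/2)`
(`isCompactOperator_comp_of_adjoint_comp_sq`).
-/

open scoped InnerProductSpace

noncomputable section

namespace WickRotation

section

variable {H : Type*} [NormedAddCommGroup H] [InnerProductSpace ℂ H]

/-! ### Densely defined bounded maps and ranges of powers -/

theorem norm_le_of_forall_inner_le {V : Set H} (hV : Dense V) {y : H} {K : ℝ}
    (hK : 0 ≤ K) (h : ∀ u ∈ V, ‖⟪y, u⟫_ℂ‖ ≤ K * ‖u‖) : ‖y‖ ≤ K := by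
  have h1 : ‖⟪y, y⟫_ℂ‖ ≤ K * ‖y‖ := by
    refine hV.induction (P := fun u => ‖⟪y, u⟫_ℂ‖ ≤ K * ‖u‖) h ?_ y
    exact isClosed_le (by fun_prop) (by fun_prop)
  rw [inner_self_eq_norm_sq_to_K, norm_pow, RCLike.norm_ofReal, abs_norm] at h1
  by_cases h0 : ‖y‖ = 0
  · rwa [h0]
  · have := lt_of_le_of_ne (norm_nonneg y) (Ne.symm h0)
    nlinarith

/-- The space `⋂ₖ ran P ^ k`. For `P = (1 + N)⁻¹` it is the space of smooth vectors of `N`. -/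
def rangePowers (P : H →L[ℂ] H) : Submodule ℂ H :=
  ⨅ k : ℕ, LinearMap.range ((P ^ k : H →L[ℂ] H) : H →ₗ[ℂ] H)

theorem mem_rangePowers {P : H →L[ℂ] H} {x : H} :
    x ∈ rangePowers P ↔ ∀ k : ℕ, ∃ u, (P ^ k) u = x := by
  simp only [rangePowers, Submodule.mem_iInf]
  rfl

theorem map_mem_rangePowers {P Q : H →L[ℂ] H} (hQ : Commute Q P) {x : H}
    (hx : x ∈ rangePowers P) : Q x ∈ rangePowers P := by
  rw [mem_rangePowers] at hx ⊢
  intro k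
  obtain ⟨u, rfl⟩ := hx k
  refine ⟨Q u, ?_⟩
  have := (hQ.pow_right k).eq
  exact (congrArg (fun T : H →L[ℂ] H => T u) this).symm

theorem exists_preimage_mem_rangePowers {P : H →L[ℂ] H} (hP : Function.Injective P) {x : H}
    (hx : x ∈ rangePowers P) : ∃ v ∈ rangePowers P, P v = x := by
  rw [mem_rangePowers] at hx
  obtain ⟨v, hv⟩ := hx 1
  rw [pow_one] at hv
  refine ⟨v, mem_rangePowers.2 fun k => ?_, hv⟩
  obtain ⟨u, hu⟩ := hx (k + 1)
  refine ⟨u, hP ?_⟩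
  rw [hv, ← hu, pow_succ']
  rfl

variable [CompleteSpace H]

theorem exists_extension_of_bound {V : Submodule ℂ H} (hV : Dense (V : Set H)) (f : V →ₗ[ℂ] H)
    (K : ℝ) (hf : ∀ v : V, ‖f v‖ ≤ K * ‖(v : H)‖) : ∃ F : H →L[ℂ] H, ∀ v : V, F v = f v :=
  ⟨f.extendOfNorm V.subtype, LinearMap.extendOfNorm_eq (by simpa using hV.denseRange_val) ⟨K, hf⟩⟩

/-- For an injective self-adjoint `P` the space `⋂ₖ ran P ^ k` is dense: it contains the range of
`g(P)` for every continuous `g` that vanishes near `0`, and `P` is a norm limit of such `g(P)`. -/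
theorem dense_rangePowers {P : H →L[ℂ] H} (hP : IsSelfAdjoint P) (hinj : Function.Injective P) :
    Dense (rangePowers P : Set H) := by
  have hrange : Dense (Set.range P) := by
    have h1 : (LinearMap.range (P : H →ₗ[ℂ] H)).topologicalClosure = ⊤ := by
      rw [Submodule.topologicalClosure_eq_top_iff, ContinuousLinearMap.orthogonal_range,
        show P.adjoint = P from hP]
      exact LinearMap.ker_eq_bot.2 hinj
    rw [← Submodule.dense_iff_topologicalClosure_eq_top] at h1
    exact h1
  have key : Set.range P ⊆ closure (rangePowers P : Set H) := by
    rintro _ ⟨x, rfl⟩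
    rw [Metric.mem_closure_iff]
    intro ε hε
    obtain ⟨η, hη, hηx⟩ : ∃ η : ℝ, 0 < η ∧ η * ‖x‖ < ε := by
      refine ⟨ε / (‖x‖ + 1), by positivity, ?_⟩
      rw [div_mul_eq_mul_div, div_lt_iff₀ (by positivity)]
      nlinarith [norm_nonneg x]
    -- `g` vanishes on `[-η, η]` and differs from the identity by at most `η`.
    let g : ℝ → ℝ := fun t => t - max (-η) (min t η)
    have hgc : Continuous g := by fun_prop
    have hmax : ∀ t : ℝ, max |t| η ≠ 0 := fun t => (lt_max_of_lt_right hη).ne'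
    refine ⟨cfc g P x, mem_rangePowers.2 fun k =>
      ⟨cfc (fun t : ℝ => g t * t ^ k / max |t| η ^ (2 * k)) P x, ?_⟩, ?_⟩
    · have hc : Continuous fun t : ℝ => g t * t ^ k / max |t| η ^ (2 * k) :=
        (by fun_prop : Continuous fun t : ℝ => g t * t ^ k).div (by fun_prop)
          fun t => pow_ne_zero _ (hmax t)
      have h1 : P ^ k * cfc (fun t : ℝ => g t * t ^ k / max |t| η ^ (2 * k)) P = cfc g P := by
        rw [← cfc_pow_id (R := ℝ) P k, ← cfc_mul _ _ P (by fun_prop) hc.continuousOn]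
        congr 1
        funext t
        by_cases ht : |t| ≤ η
        · have h2 := abs_le.1 ht
          have h3 : g t = 0 := by
            simp only [g]
            rw [min_eq_left h2.2, max_eq_right h2.1, sub_self]
          rw [h3, zero_mul, zero_div, mul_zero]
        · have h2 : max |t| η ^ (2 * k) = t ^ k * t ^ k := by
            rw [max_eq_left (not_le.1 ht).le, pow_mul, sq_abs, ← pow_mul, two_mul, pow_add]
          have h3 : t ≠ 0 := by
            rintro rfl
            exact ht (by simpa using hη.le)
          rw [h2]
          field_simp
      exact congrArg (fun T : H →L[ℂ] H => T x) h1
    · rw [dist_eq_norm]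
      have h1 : P - cfc g P = cfc (fun t : ℝ => max (-η) (min t η)) P := by
        nth_rewrite 1 [← cfc_id ℝ P]
        rw [← cfc_sub _ _ P]
        congr 1
        funext t
        simp [g]
      have h2 : ‖P - cfc g P‖ ≤ η := by
        rw [h1]
        refine norm_cfc_le hη.le fun t _ => ?_
        rw [Real.norm_eq_abs, abs_le]
        exact ⟨le_max_left _ _, max_le (by linarith) (min_le_right _ _)⟩
      calc ‖P x - cfc g P x‖ = ‖(P - cfc g P) x‖ := rfl
        _ ≤ η * ‖x‖ := (P - cfc g P).le_of_opNorm_le h2 x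
        _ < ε := hηx
  exact fun x => closure_minimal key isClosed_closure (hrange x)

/-! ### Compactness of bounded operators -/

/-- An operator is compact as soon as `X† X` is, because `‖X v‖ ^ 2 ≤ ‖X† X v‖ ‖v‖`. -/
theorem isCompactOperator_of_adjoint_comp_self {X : H →L[ℂ] H}
    (h : IsCompactOperator (X.adjoint ∘L X)) : IsCompactOperator X := by
  rw [← ContinuousLinearMap.coe_coe X,
    isCompactOperator_iff_isCompact_closure_image_closedBall (X : H →ₗ[ℂ] H) one_pos]
  rw [← ContinuousLinearMap.coe_coe,
    isCompactOperator_iff_isCompact_closure_image_closedBall _ one_pos] at h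
  refine TotallyBounded.isCompact_of_isClosed (TotallyBounded.closure ?_) isClosed_closure
  have htb := h.totallyBounded.subset subset_closure
  rw [Metric.totallyBounded_iff]
  intro ε hε
  obtain ⟨t, hts, htf, hcov⟩ :=
    Metric.finite_approx_of_totallyBounded htb (ε ^ 2 / 4) (by positivity)
  choose! c hc hc' using fun y (hy : y ∈ t) => hts hy
  refine ⟨(fun y => X (c y)) '' t, htf.image _, ?_⟩
  rintro _ ⟨v, hv, rfl⟩
  have hmem := hcov ⟨v, hv, rfl⟩
  simp only [Set.mem_iUnion, Metric.mem_ball, exists_prop] at hmem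
  obtain ⟨y, hy, hyv⟩ := hmem
  simp only [Set.mem_iUnion, Metric.mem_ball, exists_prop]
  refine ⟨X (c y), ⟨y, hy, rfl⟩, ?_⟩
  rw [dist_eq_norm] at hyv ⊢
  change ‖X v - X (c y)‖ < ε
  have h1 : ‖v - c y‖ ≤ 2 := by
    have h2 := mem_closedBall_zero_iff.1 hv
    have h3 := mem_closedBall_zero_iff.1 (hc y hy)
    linarith [norm_sub_le v (c y)]
  have h2 : ‖X.adjoint (X (v - c y))‖ < ε ^ 2 / 4 := by
    rw [← hc' y hy] at hyv
    simpa using hyv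
  have h3 : ‖X (v - c y)‖ ^ 2 ≤ ‖X.adjoint (X (v - c y))‖ * ‖v - c y‖ := by
    rw [← inner_self_eq_norm_sq (𝕜 := ℂ), ← ContinuousLinearMap.adjoint_inner_left]
    exact re_inner_le_norm _ _
  rw [← map_sub]
  nlinarith [norm_nonneg (X (v - c y)), norm_nonneg (v - c y),
    norm_nonneg (X.adjoint (X (v - c y)))]

/-- Schauder's theorem on a Hilbert space: `X X†` is compact. -/
theorem isCompactOperator_adjoint {X : H →L[ℂ] H} (h : IsCompactOperator X) :
    IsCompactOperator X.adjoint := by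
  apply isCompactOperator_of_adjoint_comp_self
  rw [ContinuousLinearMap.adjoint_adjoint]
  exact h.comp_clm X.adjoint

/-- If `L` is self-adjoint and `a† a L ^ 2` is compact, then so is `a L`. -/
theorem isCompactOperator_comp_of_adjoint_comp_sq {a L : H →L[ℂ] H} (hL : L.adjoint = L)
    (h : IsCompactOperator (a.adjoint ∘L (a ∘L (L ∘L L)))) : IsCompactOperator (a ∘L L) := by
  have h1 : IsCompactOperator (a ∘L (L ∘L L)) := by
    apply isCompactOperator_of_adjoint_comp_self
    rw [ContinuousLinearMap.adjoint_comp]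
    exact h.clm_comp (L ∘L L).adjoint
  have h2 : IsCompactOperator (L ∘L a.adjoint) := by
    apply isCompactOperator_of_adjoint_comp_self
    rw [ContinuousLinearMap.adjoint_comp, ContinuousLinearMap.adjoint_adjoint, hL]
    exact h1.comp_clm a.adjoint
  have h3 := isCompactOperator_adjoint h2
  rwa [ContinuousLinearMap.adjoint_comp, ContinuousLinearMap.adjoint_adjoint, hL] at h3

end

section

variable {H : Type*} [NormedAddCommGroup H] [InnerProductSpace ℂ H]

/-! ### Graphs and closures of unbounded operators -/

theorem pair_mem_graph_iff {T : H →ₗ.[ℂ] H} {x y : H} :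
    (x, y) ∈ T.graph ↔ ∃ h : x ∈ T.domain, T ⟨x, h⟩ = y := by
  rw [LinearPMap.mem_graph_iff]
  constructor
  · rintro ⟨u, rfl, rfl⟩
    exact ⟨u.2, rfl⟩
  · rintro ⟨h, rfl⟩
    exact ⟨⟨x, h⟩, rfl, rfl⟩

theorem graph_unique {x p q : H} {T : H →ₗ.[ℂ] H} (h : (x, p) ∈ T.graph) (h' : (x, q) ∈ T.graph) :
    p = q :=
  T.mem_graph_snd_inj h h' rfl

/-- A closed condition on pairs `(x, T x)` passes to the closure of `T`. -/
theorem closure_graph_induction {T : H →ₗ.[ℂ] H} (hT : T.IsClosable) {C : Set (H × H)}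
    (hC : IsClosed C) (h : ∀ x : T.domain, ((x : H), T x) ∈ C) (x : T.closure.domain) :
    ((x : H), T.closure x) ∈ C := by
  have h1 : ((x : H), T.closure x) ∈ T.graph.topologicalClosure := by
    rw [hT.graph_closure_eq_closure_graph]
    exact LinearPMap.mem_graph _ x
  refine closure_minimal ?_ hC h1
  rintro ⟨a, b⟩ hab
  obtain ⟨ha, rfl⟩ := pair_mem_graph_iff.1 hab
  exact h ⟨a, ha⟩

theorem closure_apply_of_mem {T : H →ₗ.[ℂ] H} {x : H} (hx : x ∈ T.domain) :
    T.closure ⟨x, T.le_closure.1 hx⟩ = T ⟨x, hx⟩ :=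
  (T.le_closure.2 (x := ⟨x, hx⟩) (y := ⟨x, T.le_closure.1 hx⟩) rfl).symm

theorem IsBoundedCommutator.graph_mem {T : H →ₗ.[ℂ] H} {a c : H →L[ℂ] H}
    (h : IsBoundedCommutator T a c) {x y : H} (hxy : (x, y) ∈ T.graph) :
    (a x, a y + c x) ∈ T.graph := by
  obtain ⟨hx, rfl⟩ := pair_mem_graph_iff.1 hxy
  obtain ⟨h1, h2⟩ := h ⟨x, hx⟩
  exact pair_mem_graph_iff.2 ⟨h1, by rw [← h2, add_sub_cancel]⟩

/-- A bounded operator that has bounded commutator with `T` has the same bounded commutator with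
the closure of `T`. -/
theorem IsBoundedCommutator.closure {T : H →ₗ.[ℂ] H} (hT : T.IsClosable) {a c : H →L[ℂ] H}
    (h : IsBoundedCommutator T a c) : IsBoundedCommutator T.closure a c := by
  intro x
  have hC : IsClosed {p : H × H | (a p.1, a p.2 + c p.1) ∈ T.closure.graph} :=
    hT.closure_isClosed.preimage (by fun_prop : Continuous fun p : H × H =>
      (a p.1, a p.2 + c p.1))
  have h1 := closure_graph_induction hT hC (fun y => ?_) x
  · obtain ⟨h2, h3⟩ := pair_mem_graph_iff.1 h1
    exact ⟨h2, by rw [h3, add_sub_cancel_left]⟩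
  · exact LinearPMap.le_graph_of_le T.le_closure (h.graph_mem (LinearPMap.mem_graph T y))

theorem norm_sub_smul_ge {T : H →ₗ.[ℂ] H} (hT : T.IsFormalAdjoint T) (c : ℂ) (x : T.domain) :
    |c.im| * ‖(x : H)‖ ≤ ‖T x - c • (x : H)‖ := by
  have h0 : (⟪(x : H), T x⟫_ℂ).im = 0 := by
    have h1 := hT x x
    rw [← inner_conj_symm] at h1
    have h2 := congrArg Complex.im h1
    rw [Complex.conj_im] at h2
    linarith
  have h1 : (⟪(x : H), T x - c • (x : H)⟫_ℂ).im = -(c.im * ‖(x : H)‖ ^ 2) := by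
    rw [inner_sub_right, inner_smul_right, Complex.sub_im, h0, inner_self_eq_norm_sq_to_K]
    simp [Complex.mul_im, ← Complex.ofReal_pow]
  have h2 : |c.im| * ‖(x : H)‖ ^ 2 ≤ ‖(x : H)‖ * ‖T x - c • (x : H)‖ := by
    refine le_trans ?_ (norm_inner_le_norm (𝕜 := ℂ) (x : H) (T x - c • (x : H)))
    refine le_trans (le_of_eq ?_) (Complex.abs_im_le_norm _)
    rw [h1, abs_neg, abs_mul, abs_of_nonneg (sq_nonneg ‖(x : H)‖)]
  by_cases h3 : ‖(x : H)‖ = 0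
  · rw [h3, mul_zero]; exact norm_nonneg _
  · have := lt_of_le_of_ne (norm_nonneg _) (Ne.symm h3)
    nlinarith

variable [CompleteSpace H]

theorem isClosable_of_isFormalAdjoint {T : H →ₗ.[ℂ] H} (hd : Dense (T.domain : Set H))
    (hT : T.IsFormalAdjoint T) : T.IsClosable :=
  (LinearPMap.adjoint_isClosed hd).isClosable.leIsClosable (hT.le_adjoint hd)

/-- A densely defined symmetric operator `T` is essentially self-adjoint if, for some non-real `c`,
the ranges of `T - c` and of `T - conj c` have trivial orthogonal complement. -/
theorem isEssentiallySelfAdjoint_of_range {T : H →ₗ.[ℂ] H} (hd : Dense (T.domain : Set H))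
    (hT : T.IsFormalAdjoint T) {c : ℂ} (hc : c.im ≠ 0)
    (h1 : ∀ ψ : H, (∀ x : T.domain, ⟪T x - c • (x : H), ψ⟫_ℂ = 0) → ψ = 0)
    (h2 : ∀ ψ : H, (∀ x : T.domain, ⟪T x - (starRingEnd ℂ c) • (x : H), ψ⟫_ℂ = 0) → ψ = 0) :
    IsEssentiallySelfAdjoint T := by
  have hcl := isClosable_of_isFormalAdjoint hd hT
  refine ⟨hcl, ?_⟩
  have hle : T ≤ T† := hT.le_adjoint hd
  have hle' : T.closure ≤ T† := by
    refine LinearPMap.le_of_le_graph ?_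
    rw [← hcl.graph_closure_eq_closure_graph]
    exact Submodule.topologicalClosure_minimal _ (LinearPMap.le_graph_of_le hle)
      (LinearPMap.adjoint_isClosed hd)
  have hd' : Dense (T.closure.domain : Set H) := hd.mono T.le_closure.1
  have hadj : T.closure† = T† := by
    refine LinearPMap.eq_of_eq_graph ?_
    rw [LinearPMap.adjoint_graph_eq_graph_adjoint hd, LinearPMap.adjoint_graph_eq_graph_adjoint hd']
    ext ⟨y, z⟩
    rw [Submodule.mem_adjoint_iff, Submodule.mem_adjoint_iff]
    constructor
    · intro h a b hab
      exact h a b (LinearPMap.le_graph_of_le T.le_closure hab)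
    · intro h a b hab
      obtain ⟨ha, rfl⟩ := pair_mem_graph_iff.1 hab
      have hC : IsClosed {p : H × H | ⟪p.2, y⟫_ℂ - ⟪p.1, z⟫_ℂ = 0} :=
        isClosed_eq (by fun_prop) (by fun_prop)
      exact closure_graph_induction hcl hC
        (fun x => h _ _ (LinearPMap.mem_graph T x)) ⟨a, ha⟩
  -- `T.closure - c` is bounded below, so its range is closed; it is also dense.
  have hsurj : ∀ g : H, ∃ x : T.closure.domain, T.closure x - c • (x : H) = g := by
    have hbd : ∀ x : T.closure.domain, |c.im| * ‖(x : H)‖ ≤ ‖T.closure x - c • (x : H)‖ := by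
      have hC : IsClosed {p : H × H | |c.im| * ‖p.1‖ ≤ ‖p.2 - c • p.1‖} :=
        isClosed_le (by fun_prop) (by fun_prop)
      exact fun x => closure_graph_induction hcl hC (norm_sub_smul_ge hT c) x
    have : CompleteSpace T.closure.graph := hcl.closure_isClosed.completeSpace_coe
    let f : T.closure.graph →L[ℂ] H :=
      (ContinuousLinearMap.snd ℂ H H - c • ContinuousLinearMap.fst ℂ H H) ∘L
        T.closure.graph.subtypeL
    have hpos : 0 < |c.im| := abs_pos.2 hc
    have hf : ∀ p : T.closure.graph, ‖p‖ ≤ (1 + (1 + ‖c‖) * |c.im|⁻¹) * ‖f p‖ := by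
      rintro ⟨⟨x, z⟩, hp⟩
      obtain ⟨hx, rfl⟩ := pair_mem_graph_iff.1 hp
      have h3 := hbd ⟨x, hx⟩
      change max ‖x‖ ‖T.closure ⟨x, hx⟩‖ ≤ (1 + (1 + ‖c‖) * |c.im|⁻¹) *
        ‖T.closure ⟨x, hx⟩ - c • x‖
      have h4 : ‖x‖ ≤ |c.im|⁻¹ * ‖T.closure ⟨x, hx⟩ - c • x‖ := by
        rw [inv_mul_eq_div, le_div_iff₀ hpos, mul_comm]
        exact h3
      have h5 : ‖T.closure ⟨x, hx⟩‖ ≤ ‖T.closure ⟨x, hx⟩ - c • x‖ + ‖c‖ * ‖x‖ := by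
        rw [← norm_smul]
        exact norm_le_norm_sub_add _ _
      have h6 := mul_le_mul_of_nonneg_left h4 (norm_nonneg c)
      have h7 := norm_nonneg (T.closure ⟨x, hx⟩ - c • x)
      have h8 : 0 ≤ |c.im|⁻¹ * ‖T.closure ⟨x, hx⟩ - c • x‖ := by positivity
      have h9 : 0 ≤ ‖c‖ * (|c.im|⁻¹ * ‖T.closure ⟨x, hx⟩ - c • x‖) := by positivity
      refine max_le ?_ ?_ <;> nlinarith
    have hanti : AntilipschitzWith ⟨1 + (1 + ‖c‖) * |c.im|⁻¹, by positivity⟩ f :=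
      ContinuousLinearMap.antilipschitz_of_bound f hf
    have hrc : IsClosed (Set.range f) := hanti.isClosed_range f.uniformContinuous
    have hrange : LinearMap.range (f : T.closure.graph →ₗ[ℂ] H) = ⊤ := by
      have hc' : IsClosed ((LinearMap.range (f : T.closure.graph →ₗ[ℂ] H) : Submodule ℂ H) :
        Set H) := hrc
      rw [← hc'.submodule_topologicalClosure_eq, Submodule.topologicalClosure_eq_top_iff,
        Submodule.eq_bot_iff]
      intro w hw
      refine h1 w fun x => hw _ ?_
      exact ⟨⟨((x : H), T x), LinearPMap.le_graph_of_le T.le_closure (LinearPMap.mem_graph T x)⟩,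
        rfl⟩
    intro g
    obtain ⟨⟨⟨x, z⟩, hp⟩, hxz⟩ : g ∈ LinearMap.range (f : T.closure.graph →ₗ[ℂ] H) := by
      rw [hrange]; trivial
    obtain ⟨hx, rfl⟩ := pair_mem_graph_iff.1 hp
    exact ⟨⟨x, hx⟩, hxz⟩
  have hge : T† ≤ T.closure := by
    refine LinearPMap.le_of_le_graph ?_
    rintro ⟨y, z⟩ hyz
    obtain ⟨x, hx⟩ := hsurj (z - c • y)
    have hxg := LinearPMap.mem_graph T.closure x
    have hdiff := T†.graph.sub_mem hyz (LinearPMap.le_graph_of_le hle' hxg)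
    rw [Prod.mk_sub_mk, LinearPMap.adjoint_graph_eq_graph_adjoint hd,
      Submodule.mem_adjoint_iff] at hdiff
    have hz : z - T.closure x = c • (y - x) := by
      rw [smul_sub, sub_eq_sub_iff_add_eq_add]
      have := sub_eq_sub_iff_add_eq_add.1 hx
      rw [← this, add_comm]
    have hy : y - (x : H) = 0 := by
      refine h2 _ fun u => ?_
      have h3 := hdiff _ _ (LinearPMap.mem_graph T u)
      simp only [hz, inner_smul_right] at h3
      rw [inner_sub_left, inner_smul_left, Complex.conj_conj]
      exact h3
    rw [hy, smul_zero] at hz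
    rwa [sub_eq_zero.1 hy, sub_eq_zero.1 hz]
  change T.closure† = T.closure
  rw [hadj]
  exact le_antisymm hge hle'

end

section

variable {H : Type*} [NormedAddCommGroup H] [InnerProductSpace ℂ H]

/-! ### Powers of an unbounded operator in terms of its resolvent -/

theorem mulOp_graph {S T : H →ₗ.[ℂ] H} {x z : H} :
    (x, z) ∈ (mulOp S T).graph ↔ ∃ y, (x, y) ∈ T.graph ∧ (y, z) ∈ S.graph := by
  simp only [pair_mem_graph_iff]
  constructor
  · rintro ⟨⟨h, h'⟩, rfl⟩
    exact ⟨_, ⟨h, rfl⟩, h', rfl⟩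
  · rintro ⟨y, ⟨h, rfl⟩, h', rfl⟩
    exact ⟨⟨h, h'⟩, rfl⟩

theorem powOp_zero_graph {T : H →ₗ.[ℂ] H} {x y : H} : (x, y) ∈ (powOp T 0).graph ↔ x = y := by
  rw [pair_mem_graph_iff]
  exact ⟨fun ⟨_, h⟩ => h, fun h => ⟨trivial, h⟩⟩

theorem IsOneAddInv.injective {N : H →ₗ.[ℂ] H} {P : H →L[ℂ] H} (h : IsOneAddInv N P) :
    Function.Injective P := by
  rw [injective_iff_map_eq_zero]
  intro x hx
  obtain ⟨h1, h2⟩ := h.1 x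
  have h3 : (⟨P x, h1⟩ : N.domain) = 0 := Subtype.ext hx
  rw [h3, N.map_zero, hx, add_zero] at h2
  exact h2.symm

theorem IsOneAddInv.graph_iff {N : H →ₗ.[ℂ] H} {P : H →L[ℂ] H} (h : IsOneAddInv N P) {x y : H} :
    (x, y) ∈ N.graph ↔ ∃ u, P u = x ∧ (1 - P) u = y := by
  rw [pair_mem_graph_iff]
  constructor
  · rintro ⟨hx, rfl⟩
    have h1 : P (x + N ⟨x, hx⟩) = x := h.2 ⟨x, hx⟩
    refine ⟨x + N ⟨x, hx⟩, h1, ?_⟩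
    change (x + N ⟨x, hx⟩) - P _ = _
    rw [h1, add_sub_cancel_left]
  · rintro ⟨u, rfl, rfl⟩
    obtain ⟨h1, h2⟩ := h.1 u
    refine ⟨h1, ?_⟩
    change _ = u - P u
    rw [eq_sub_iff_add_eq, add_comm, h2]

theorem IsOneAddInv.powOp_graph_iff {N : H →ₗ.[ℂ] H} {P : H →L[ℂ] H} (h : IsOneAddInv N P)
    (k : ℕ) {x y : H} :
    (x, y) ∈ (powOp N k).graph ↔ ∃ u, (P ^ k) u = x ∧ ((1 - P) ^ k) u = y := by
  induction k generalizing x y with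
  | zero =>
    rw [powOp_zero_graph]
    exact ⟨fun hxy => ⟨x, rfl, hxy⟩, fun ⟨u, h1, h2⟩ => h1.symm.trans h2⟩
  | succ k ih =>
    have hcomm : Commute P (1 - P) := (Commute.one_right P).sub_right (Commute.refl P)
    rw [powOp, mulOp_graph]
    constructor
    · rintro ⟨z, hz, hzy⟩
      obtain ⟨u, rfl, rfl⟩ := ih.1 hz
      obtain ⟨v, hv, rfl⟩ := h.graph_iff.1 hzy
      -- `u` is in the range of `P`, since `(1 - P) ^ k u` is.
      obtain ⟨w, rfl⟩ : ∃ w, P w = u := by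
        have h1 : P * ∑ i ∈ Finset.range k, (1 - P) ^ i = 1 - (1 - P) ^ k := by
          have := mul_neg_geom_sum (1 - P) k
          rwa [sub_sub_cancel] at this
        refine ⟨v + (∑ i ∈ Finset.range k, (1 - P) ^ i) u, ?_⟩
        rw [map_add, hv]
        have h2 := congrArg (fun T : H →L[ℂ] H => T u) h1
        change P ((∑ i ∈ Finset.range k, (1 - P) ^ i) u) = u - ((1 - P) ^ k) u at h2
        rw [h2, add_sub_cancel]
      refine ⟨w, by rw [pow_succ]; rfl, ?_⟩
      have h3 : v = ((1 - P) ^ k) w := by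
        apply h.injective
        rw [hv]
        exact (congrArg (fun T : H →L[ℂ] H => T w) (hcomm.pow_right k).eq).symm
      rw [h3, pow_succ']
      rfl
    · rintro ⟨w, rfl, rfl⟩
      refine ⟨((1 - P) ^ k) (P w), ih.2 ⟨P w, by rw [pow_succ]; rfl, rfl⟩, ?_⟩
      refine h.graph_iff.2 ⟨((1 - P) ^ k) w, ?_, by rw [pow_succ']; rfl⟩
      exact congrArg (fun T : H →L[ℂ] H => T w) (hcomm.pow_right k).eq

theorem IsOneAddInv.smoothDomain_eq {N : H →ₗ.[ℂ] H} {P : H →L[ℂ] H} (h : IsOneAddInv N P) :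
    smoothDomain N = rangePowers P := by
  refine iInf_congr fun k => ?_
  ext x
  constructor
  · intro hx
    obtain ⟨u, hu, -⟩ := (h.powOp_graph_iff k).1 (LinearPMap.mem_graph _ ⟨x, hx⟩)
    exact ⟨u, hu⟩
  · rintro ⟨u, rfl⟩
    exact (pair_mem_graph_iff.1 ((h.powOp_graph_iff k).2 ⟨u, rfl, rfl⟩)).1

theorem IsOneAddInvSqrt.injective {N : H →ₗ.[ℂ] H} {W : H →L[ℂ] H} (h : IsOneAddInvSqrt N W) :
    Function.Injective W :=
  fun _ _ hxy => h.2.injective (congrArg W hxy)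

variable [CompleteSpace H]

theorem isOneAddInvSqrt_oneAddInvSqrt {N : H →ₗ.[ℂ] H} (hN : IsSelfAdjoint N)
    (hpos : ∀ x : N.domain, 0 ≤ (inner ℂ (x : H) (N x)).re) :
    IsOneAddInvSqrt N (oneAddInvSqrt N) := by
  obtain ⟨S, hS, -⟩ := existsUnique_isOneAddInvSqrt hN hpos
  rwa [oneAddInvSqrt_eq hS]

theorem IsOneAddInvSqrt.oneAddSqrt_graph_iff {N : H →ₗ.[ℂ] H} {W : H →L[ℂ] H}
    (h : IsOneAddInvSqrt N W) {x y : H} : (x, y) ∈ (oneAddSqrt N).graph ↔ W y = x := by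
  rw [oneAddSqrt, oneAddInvSqrt_eq h, LinearPMap.inverse_graph]
  · rw [Submodule.mem_map]
    constructor
    · rintro ⟨⟨a, b⟩, hab, hxy⟩
      obtain ⟨_, hab'⟩ := pair_mem_graph_iff.1 hab
      have h1 : b = x := congrArg Prod.fst hxy
      have h2 : a = y := congrArg Prod.snd hxy
      rw [← h1, ← h2]
      exact hab'
    · rintro rfl
      exact ⟨(y, W y), pair_mem_graph_iff.2 ⟨trivial, rfl⟩, rfl⟩
  · rw [LinearMap.ker_eq_bot]
    exact fun a b hab => Subtype.ext (h.injective hab)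

/-! ### Pseudodifferential operators of order two -/

/-- On `Λ = W⁻¹`, `δ(B) = B'` means `B W = W B + W B' W`. -/
theorem IsOneAddInvSqrt.apply_of_isBoundedCommutator {N : H →ₗ.[ℂ] H} {W : H →L[ℂ] H}
    (h : IsOneAddInvSqrt N W) {B B' : H →L[ℂ] H} (hB : IsBoundedCommutator (oneAddSqrt N) B B')
    (u : H) : B (W u) = W (B u) + W (B' (W u)) := by
  obtain ⟨hu, hu'⟩ := pair_mem_graph_iff.1 (h.oneAddSqrt_graph_iff.2 (rfl : W u = W u))
  obtain ⟨h1, h2⟩ := hB ⟨W u, hu⟩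
  rw [hu'] at h2
  have h3 := h.oneAddSqrt_graph_iff.1 (LinearPMap.mem_graph _ ⟨B (W u), h1⟩)
  rw [sub_eq_iff_eq_add.1 h2, map_add, add_comm] at h3
  exact h3.symm

/-- An operator in `dom δ ^ 2` preserves `dom N`: if `P = (1 + N)⁻¹`, then `B P = P C` with `C`
bounded. -/
theorem IsOneAddInvSqrt.exists_comp_eq_of_mem_domDelta {N : H →ₗ.[ℂ] H} {W : H →L[ℂ] H}
    (h : IsOneAddInvSqrt N W) {B : H →L[ℂ] H} (hB : B ∈ domDelta (oneAddSqrt N) 2) :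
    ∃ C : H →L[ℂ] H, ∀ u, B ((W ∘L W) u) = (W ∘L W) (C u) := by
  obtain ⟨B₁, hB₁, B₂, hB₂, -⟩ := hB
  refine ⟨B + B₁ ∘L W + (B₁ + B₂ ∘L W) ∘L W, fun u => ?_⟩
  have h1 := h.apply_of_isBoundedCommutator hB₁
  have h2 := h.apply_of_isBoundedCommutator hB₂
  simp only [ContinuousLinearMap.comp_apply, add_apply]
  rw [h1 (W u), h1 u, h2 (W u)]
  simp only [map_add]

/-- Membership in `OP ^ 2`, multiplied by `P = (1 + N)⁻¹`. -/
theorem IsOneAddInvSqrt.apply_of_mem_powOp_two {N : H →ₗ.[ℂ] H} {W : H →L[ℂ] H}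
    (h : IsOneAddInvSqrt N W) {y z : H} (hyz : (y, z) ∈ (powOp (oneAddSqrt N) 2).graph) :
    (W ∘L W) z = y := by
  obtain ⟨a, ha, haz⟩ := mulOp_graph.1 hyz
  obtain ⟨b, hb, hba⟩ := mulOp_graph.1 ha
  rw [powOp_zero_graph] at hb
  rw [ContinuousLinearMap.comp_apply, h.oneAddSqrt_graph_iff.1 haz, h.oneAddSqrt_graph_iff.1 hba,
    hb]

/-! ### The commutator argument -/

/-- A form of Nelson's commutator theorem. Read `P` as `(1 + N)⁻¹` and `V` as the smooth vectors of
`N`. The hypotheses say that `R` is symmetric, form bounded with respect to `N`, and that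
`[N, R] = (1 + N) B` with `B` preserving `dom N`. Then for large real `κ` the range of
`N + R - i κ` has trivial orthogonal complement. -/
theorem eq_zero_of_commutator {P B C : H →L[ℂ] H} (hP : P.adjoint = P)
    (hinj : Function.Injective P) {V : Submodule ℂ H} (hV : Dense (V : Set H))
    (hPV : ∀ v ∈ V, P v ∈ V) (R : V →ₗ[ℂ] H) (hR : ∀ x y : V, ⟪R x, (y : H)⟫_ℂ = ⟪(x : H), R y⟫_ℂ)
    {K : ℝ} (hK : 0 ≤ K)
    (hbd : ∀ v u : V, ‖⟪R ⟨P v, hPV v v.2⟩, P u⟫_ℂ‖ ≤ K * ‖(v : H)‖ * ‖(u : H)‖)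
    (hB : ∀ v : V, R ⟨P v, hPV v v.2⟩ = P (R v) + B (P v)) (hC : ∀ u, B (P u) = P (C u))
    {κ : ℝ} (hκ : ‖C‖ < |κ|) {ψ : H}
    (hψ : ∀ v : V, ⟪(v : H) - P v + R ⟨P v, hPV v v.2⟩ - (κ * Complex.I) • P v, ψ⟫_ℂ = 0) :
    ψ = 0 := by
  have hsymm : ∀ x y : H, ⟪P x, y⟫_ℂ = ⟪x, P y⟫_ℂ := fun x y => by
    rw [← ContinuousLinearMap.adjoint_inner_right, hP]
  -- `Z` is the bounded extension of `P R P`.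
  obtain ⟨Z, hZ⟩ := exists_extension_of_bound hV
    ((P : H →ₗ[ℂ] H) ∘ₗ R ∘ₗ (P : H →ₗ[ℂ] H).restrict hPV) K (fun v => by
      refine norm_le_of_forall_inner_le hV (mul_nonneg hK (norm_nonneg _)) fun u hu => ?_
      change ‖⟪P (R ⟨P v, hPV v v.2⟩), u⟫_ℂ‖ ≤ _
      rw [hsymm]
      exact hbd v ⟨u, hu⟩)
  replace hZ : ∀ v : V, Z v = P (R ⟨P v, hPV v v.2⟩) := hZ
  have hZim : (⟪Z ψ, ψ⟫_ℂ).im = 0 := by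
    refine hV.induction (P := fun x => (⟪Z x, x⟫_ℂ).im = 0) (fun v hv => ?_)
      (isClosed_eq (by fun_prop) (by fun_prop)) ψ
    rw [hZ ⟨v, hv⟩, hsymm]
    have h1 := hR ⟨P v, hPV v hv⟩ ⟨P v, hPV v hv⟩
    rw [← inner_conj_symm (P v)] at h1
    have h2 := congrArg Complex.im h1
    rw [Complex.conj_im] at h2
    simp only at h2 ⊢
    linarith
  -- The test vectors `P ^ 2 w`, with `w` in `V`, extend to all `w`, in particular to `w = ψ`.
  have hmain : ⟪P ψ - P (P ψ) + (Z ψ + P (C (P ψ))) - (κ * Complex.I) • P (P ψ), ψ⟫_ℂ = 0 := by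
    refine hV.induction (P := fun w =>
      ⟪P w - P (P w) + (Z w + P (C (P w))) - (κ * Complex.I) • P (P w), ψ⟫_ℂ = 0)
      (fun w hw => ?_) (isClosed_eq (by fun_prop) (by fun_prop)) ψ
    have h1 := hψ ⟨P w, hPV w hw⟩
    rw [hB] at h1
    rwa [hZ ⟨w, hw⟩, ← hC]
  have hPim : (⟪P ψ, ψ⟫_ℂ).im = 0 := by
    have h1 := hsymm ψ ψ
    rw [← inner_conj_symm ψ] at h1
    have h2 := congrArg Complex.im h1
    rw [Complex.conj_im] at h2
    linarith
  rw [inner_sub_left, inner_add_left, inner_sub_left, inner_add_left, inner_smul_left,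
    hsymm (P ψ), hsymm (C (P ψ)), inner_self_eq_norm_sq_to_K] at hmain
  have him := congrArg Complex.im hmain
  have h3 : (⟪C (P ψ), P ψ⟫_ℂ).im + κ * ‖P ψ‖ ^ 2 = 0 := by
    simp [hZim, hPim, ← Complex.ofReal_pow] at him
    linarith
  have h4 : |(⟪C (P ψ), P ψ⟫_ℂ).im| ≤ ‖C‖ * ‖P ψ‖ ^ 2 := by
    refine (Complex.abs_im_le_norm _).trans ((norm_inner_le_norm _ _).trans ?_)
    rw [pow_two, ← mul_assoc]
    exact mul_le_mul_of_nonneg_right (C.le_opNorm _) (norm_nonneg _)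
  have h5 : |κ| * ‖P ψ‖ ^ 2 = |(⟪C (P ψ), P ψ⟫_ℂ).im| := by
    rw [eq_neg_of_add_eq_zero_left h3, abs_neg, abs_mul, abs_of_nonneg (sq_nonneg ‖P ψ‖)]
  have h6 : ‖P ψ‖ ^ 2 = 0 := by
    by_contra h
    have := lt_of_le_of_ne (sq_nonneg ‖P ψ‖) (Ne.symm h)
    nlinarith
  have h7 : P ψ = 0 := norm_eq_zero.1 (pow_eq_zero_iff two_ne_zero |>.1 h6)
  exact hinj (h7.trans (map_zero P).symm)

/-! ### Graphs of the operators built from `D` -/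

section Graphs
variable {D : H →ₗ.[ℂ] H} {x y z a r p q p' q' : H}

theorem adjoint_graph_inner (hd : Dense (D.domain : Set H)) (h : (x, p) ∈ D.graph)
    (h' : (y, q) ∈ D†.graph) : ⟪q, x⟫_ℂ = ⟪y, p⟫_ℂ := by
  obtain ⟨hx, rfl⟩ := pair_mem_graph_iff.1 h
  obtain ⟨hy, rfl⟩ := pair_mem_graph_iff.1 h'
  exact LinearPMap.adjoint_isFormalAdjoint hd ⟨y, hy⟩ ⟨x, hx⟩

theorem absSq_graph (h : (x, z) ∈ (absSq D).graph) :
    ∃ p q p' q', (x, p) ∈ D.graph ∧ (x, q) ∈ D†.graph ∧ (p, p') ∈ D†.graph ∧ (q, q') ∈ D.graph ∧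
      z = (1 / 2 : ℂ) • (q' + p') := by
  obtain ⟨⟨h1, h2⟩, rfl⟩ := pair_mem_graph_iff.1 h
  obtain ⟨q, hq, hq'⟩ := mulOp_graph.1 (LinearPMap.mem_graph _ ⟨x, h1⟩)
  obtain ⟨p, hp, hp'⟩ := mulOp_graph.1 (LinearPMap.mem_graph _ ⟨x, h2⟩)
  exact ⟨p, q, _, _, hp, hq, hp', hq', rfl⟩

theorem remainder_graph (h : (x, z) ∈ (remainder D).graph) :
    ∃ p q p' q', (x, p) ∈ D.graph ∧ (x, q) ∈ D†.graph ∧ (p, p') ∈ D.graph ∧ (q, q') ∈ D†.graph ∧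
      z = (Complex.I / 2) • (p' - q') := by
  obtain ⟨⟨h1, h2⟩, rfl⟩ := pair_mem_graph_iff.1 h
  obtain ⟨p, hp, hp'⟩ := mulOp_graph.1 (LinearPMap.mem_graph _ ⟨x, h1⟩)
  obtain ⟨q, hq, hq'⟩ := mulOp_graph.1 (LinearPMap.mem_graph _ ⟨x, h2⟩)
  exact ⟨p, q, _, _, hp, hq, hp', hq', rfl⟩

theorem wickRotation_graph_iff : (x, z) ∈ (wickRotation D).graph ↔
    ∃ p q, (x, p) ∈ D.graph ∧ (x, q) ∈ D†.graph ∧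
      z = ((1 + Complex.I) / 2) • p + ((1 - Complex.I) / 2) • q := by
  have key : ∀ p q : H, (1 / 2 : ℂ) • (p + q) + (Complex.I / 2) • (p - q) =
      ((1 + Complex.I) / 2) • p + ((1 - Complex.I) / 2) • q := fun p q => by module
  rw [pair_mem_graph_iff]
  constructor
  · rintro ⟨⟨⟨h1, h2⟩, h3⟩, rfl⟩
    exact ⟨_, _, LinearPMap.mem_graph D ⟨x, h1⟩, LinearPMap.mem_graph D† ⟨x, h2⟩, key _ _⟩
  · rintro ⟨p, q, hp, hq, rfl⟩
    obtain ⟨h1, rfl⟩ := pair_mem_graph_iff.1 hp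
    obtain ⟨h2, rfl⟩ := pair_mem_graph_iff.1 hq
    exact ⟨⟨⟨h1, h2⟩, h1, h2⟩, key _ _⟩

theorem absSq_inner (hd : Dense (D.domain : Set H)) (h : (x, z) ∈ (absSq D).graph)
    (hp : (x, p) ∈ D.graph) (hq : (x, q) ∈ D†.graph) :
    (⟪x, z⟫_ℂ).re = (‖p‖ ^ 2 + ‖q‖ ^ 2) / 2 := by
  obtain ⟨p₁, q₁, p', q', hp₁, hq₁, hp', hq', rfl⟩ := absSq_graph h
  obtain rfl := graph_unique hp hp₁
  obtain rfl := graph_unique hq hq₁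
  have h1 : ⟪x, q'⟫_ℂ = ⟪q, q⟫_ℂ := (adjoint_graph_inner hd hq' hq).symm
  have h2 : ⟪x, p'⟫_ℂ = ⟪p, p⟫_ℂ := by
    rw [← inner_conj_symm, adjoint_graph_inner hd hp hp', inner_conj_symm]
  rw [inner_smul_right, inner_add_right, h1, h2, inner_self_eq_norm_sq_to_K,
    inner_self_eq_norm_sq_to_K]
  simp [← Complex.ofReal_pow, ← Complex.ofReal_add]
  ring

theorem remainder_inner (hd : Dense (D.domain : Set H)) (h : (x, z) ∈ (remainder D).graph)
    (hp : (x, p) ∈ D.graph) (hq : (x, q) ∈ D†.graph) (hp' : (y, p') ∈ D.graph)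
    (hq' : (y, q') ∈ D†.graph) :
    ⟪z, y⟫_ℂ = -(Complex.I / 2) * (⟪p, q'⟫_ℂ - ⟪q, p'⟫_ℂ) := by
  obtain ⟨p₁, q₁, r, s, hp₁, hq₁, hr, hs, rfl⟩ := remainder_graph h
  obtain rfl := graph_unique hp hp₁
  obtain rfl := graph_unique hq hq₁
  have h1 : ⟪r, y⟫_ℂ = ⟪p, q'⟫_ℂ := by
    rw [← inner_conj_symm, ← adjoint_graph_inner hd hr hq', inner_conj_symm]
  rw [inner_smul_left, inner_sub_left, h1, adjoint_graph_inner hd hp' hs, map_div₀, Complex.conj_I,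
    map_ofNat]
  ring

/-- `R_D` is symmetric. -/
theorem remainder_symm (hd : Dense (D.domain : Set H)) (h : (x, z) ∈ (remainder D).graph)
    (h' : (y, r) ∈ (remainder D).graph) : ⟪z, y⟫_ℂ = ⟪x, r⟫_ℂ := by
  obtain ⟨p, q, -, -, hp, hq, -, -, -⟩ := remainder_graph h
  obtain ⟨p', q', -, -, hp', hq', -, -, -⟩ := remainder_graph h'
  rw [← inner_conj_symm x, remainder_inner hd h hp hq hp' hq', remainder_inner hd h' hp' hq' hp hq]
  simp only [map_mul, map_neg, map_div₀, map_sub, inner_conj_symm, Complex.conj_I, map_ofNat]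
  ring

/-- `D_E ^ 2 = ⟨D⟩ ^ 2 + R_D`. -/
theorem wickRotation_sq (h : (x, a) ∈ (absSq D).graph) (h' : (x, r) ∈ (remainder D).graph) :
    ∃ y, (x, y) ∈ (wickRotation D).graph ∧ (y, a + r) ∈ (wickRotation D).graph := by
  obtain ⟨p, q, p', q', hp, hq, hp', hq', rfl⟩ := absSq_graph h
  obtain ⟨p₁, q₁, p'', q'', hp₁, hq₁, hp'', hq'', rfl⟩ := remainder_graph h'
  obtain rfl := graph_unique hp hp₁
  obtain rfl := graph_unique hq hq₁
  refine ⟨_, wickRotation_graph_iff.2 ⟨p, q, hp, hq, rfl⟩, wickRotation_graph_iff.2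
    ⟨((1 + Complex.I) / 2) • p'' + ((1 - Complex.I) / 2) • q',
      ((1 + Complex.I) / 2) • p' + ((1 - Complex.I) / 2) • q'',
      D.graph.add_mem (D.graph.smul_mem _ hp'') (D.graph.smul_mem _ hq'),
      D†.graph.add_mem (D†.graph.smul_mem _ hp') (D†.graph.smul_mem _ hq''), ?_⟩⟩
  match_scalars <;> ring_nf <;> simp only [Complex.I_sq] <;> ring

/-- `D_E ^ 2 - c ^ 2` factors through `D_E - c`. -/
theorem exists_wickRotation_sub_sq_graph (ha : (x, a) ∈ (absSq D).graph)
    (hr : (x, r) ∈ (remainder D).graph) (c : ℂ) :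
    ∃ y, (y, a + r - (c * c) • x + c • y) ∈ (wickRotation D).graph := by
  obtain ⟨y, hxy, hy⟩ := wickRotation_sq ha hr
  refine ⟨y + c • x, ?_⟩
  convert (wickRotation D).graph.add_mem hy ((wickRotation D).graph.smul_mem c hxy) using 1
  rw [Prod.smul_mk, Prod.mk_add_mk, Prod.mk.injEq]
  exact ⟨rfl, by module⟩

theorem wickRotation_isFormalAdjoint (hd : Dense (D.domain : Set H)) :
    (wickRotation D).IsFormalAdjoint (wickRotation D) := by
  intro x y
  obtain ⟨p, q, hp, hq, hx⟩ := wickRotation_graph_iff.1 (LinearPMap.mem_graph _ x)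
  obtain ⟨p', q', hp', hq', hy⟩ := wickRotation_graph_iff.1 (LinearPMap.mem_graph _ y)
  have h1 : ⟪p, (y : H)⟫_ℂ = ⟪(x : H), q'⟫_ℂ := by
    rw [← inner_conj_symm, ← adjoint_graph_inner hd hp hq', inner_conj_symm]
  rw [hx, hy, inner_add_left, inner_add_right, inner_smul_left, inner_smul_left, inner_smul_right,
    inner_smul_right, h1, adjoint_graph_inner hd hp' hq]
  simp only [map_div₀, map_add, map_sub, map_one, Complex.conj_I, map_ofNat]
  ring

/-- `‖D_E x‖ ^ 2 ≤ ‖D x‖ ^ 2 + ‖D† x‖ ^ 2`. -/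
theorem wickRotation_norm_sq_le (h : (x, z) ∈ (wickRotation D).graph)
    (hp : (x, p) ∈ D.graph) (hq : (x, q) ∈ D†.graph) : ‖z‖ ^ 2 ≤ ‖p‖ ^ 2 + ‖q‖ ^ 2 := by
  obtain ⟨p₁, q₁, hp₁, hq₁, rfl⟩ := wickRotation_graph_iff.1 h
  obtain rfl := graph_unique hp hp₁
  obtain rfl := graph_unique hq hq₁
  have h1 : ‖(1 + Complex.I) / 2‖ ^ 2 = 1 / 2 := by
    rw [← Complex.normSq_eq_norm_sq]; norm_num [Complex.normSq_apply]
  have h2 : ‖(1 - Complex.I) / 2‖ ^ 2 = 1 / 2 := by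
    rw [← Complex.normSq_eq_norm_sq]; norm_num [Complex.normSq_apply]
  have h3 := norm_add_le (((1 + Complex.I) / 2) • p) (((1 - Complex.I) / 2) • q)
  rw [norm_smul, norm_smul] at h3
  have h4 : (‖(1 + Complex.I) / 2‖ * ‖p‖ + ‖(1 - Complex.I) / 2‖ * ‖q‖) ^ 2 ≤
      ‖p‖ ^ 2 + ‖q‖ ^ 2 := by
    nlinarith [sq_nonneg (‖(1 + Complex.I) / 2‖ * ‖p‖ - ‖(1 - Complex.I) / 2‖ * ‖q‖),
      mul_pow ‖(1 + Complex.I) / 2‖ ‖p‖ 2, mul_pow ‖(1 - Complex.I) / 2‖ ‖q‖ 2]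
  exact (pow_le_pow_left₀ (norm_nonneg _) h3 2).trans h4

theorem wickRotation_eq : wickRotation D =
    (Complex.exp (Complex.I * (Real.pi : ℂ) / 4) / (Real.sqrt 2 : ℂ)) • (D - Complex.I • D†) := by
  have hs : (Real.sqrt 2 : ℂ) ^ 2 = 2 := by
    rw [← Complex.ofReal_pow, Real.sq_sqrt (by norm_num)]; norm_num
  have hs0 : (Real.sqrt 2 : ℂ) ≠ 0 := by
    intro h; rw [h] at hs; norm_num at hs
  have hexp : Complex.exp (Complex.I * (Real.pi : ℂ) / 4) / (Real.sqrt 2 : ℂ) =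
      (1 + Complex.I) / 2 := by
    have h1 : Complex.I * (Real.pi : ℂ) / 4 = ((Real.pi / 4 : ℝ) : ℂ) * Complex.I := by
      push_cast; ring
    rw [h1, Complex.exp_mul_I, ← Complex.ofReal_cos, ← Complex.ofReal_sin, Real.cos_pi_div_four,
      Real.sin_pi_div_four]
    push_cast
    field_simp
  rw [hexp]
  refine LinearPMap.ext ?_ ?_
  · exact inf_idem _
  · intro x hx hx'
    change (1 / 2 : ℂ) • (D ⟨x, hx'.1⟩ + D† ⟨x, hx'.2⟩) +
      (Complex.I / 2) • (D ⟨x, hx'.1⟩ - D† ⟨x, hx'.2⟩) =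
      ((1 + Complex.I) / 2) • (D ⟨x, hx'.1⟩ - Complex.I • D† ⟨x, hx'.2⟩)
    match_scalars
    · ring
    · linear_combination (1 / 2 : ℂ) * Complex.I_sq

end Graphs

/-! ### Essential self-adjointness of the Wick rotation -/

namespace IsPseudoRiemannianSpectralTriple

variable {A : Type*} [NonUnitalRing A] [StarRing A] [Module ℂ A]
  {π : A →⋆ₙₐ[ℂ] (H →L[ℂ] H)} {D : H →ₗ.[ℂ] H} (hD : IsPseudoRiemannianSpectralTriple π D)
include hD

theorem isOneAddInvSqrt : IsOneAddInvSqrt (absSq D).closure (oneAddInvSqrt (absSq D).closure) := by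
  refine isOneAddInvSqrt_oneAddInvSqrt hD.absSq_essentiallySelfAdjoint.2 fun x => ?_
  have hC : IsClosed {p : H × H | 0 ≤ (⟪p.1, p.2⟫_ℂ).re} :=
    isClosed_le continuous_const (by fun_prop)
  refine closure_graph_induction hD.absSq_essentiallySelfAdjoint.1 hC (fun y => ?_) x
  have hy := LinearPMap.mem_graph _ y
  obtain ⟨p, q, -, -, hp, hq, -, -, -⟩ := absSq_graph hy
  change 0 ≤ (⟪(y : H), absSq D y⟫_ℂ).re
  rw [absSq_inner hD.dense_domain hy hp hq]
  positivity

theorem adjoint_oneAddInvSqrt :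
    (oneAddInvSqrt (absSq D).closure).adjoint = oneAddInvSqrt (absSq D).closure :=
  hD.isOneAddInvSqrt.1.isSelfAdjoint

theorem isOneAddInv : IsOneAddInv (absSq D).closure (oneAddInv (absSq D).closure) :=
  hD.isOneAddInvSqrt.2

theorem adjoint_oneAddInv :
    (oneAddInv (absSq D).closure).adjoint = oneAddInv (absSq D).closure := by
  rw [oneAddInv, ContinuousLinearMap.adjoint_comp, hD.adjoint_oneAddInvSqrt]

theorem dense_smoothDomain : Dense (smoothDomain (absSq D).closure : Set H) := by
  rw [hD.isOneAddInv.smoothDomain_eq]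
  exact dense_rangePowers hD.adjoint_oneAddInv hD.isOneAddInv.injective

theorem oneAddInv_mem {v : H} (hv : v ∈ smoothDomain (absSq D).closure) :
    oneAddInv (absSq D).closure v ∈ smoothDomain (absSq D).closure := by
  rw [hD.isOneAddInv.smoothDomain_eq] at hv ⊢
  exact map_mem_rangePowers (Commute.refl _) hv

theorem oneAddInvSqrt_mem {v : H} (hv : v ∈ smoothDomain (absSq D).closure) :
    oneAddInvSqrt (absSq D).closure v ∈ smoothDomain (absSq D).closure := by
  rw [hD.isOneAddInv.smoothDomain_eq] at hv ⊢
  exact map_mem_rangePowers ((Commute.refl _).mul_right (Commute.refl _)) hv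

theorem absSq_oneAddInv_graph {v : H} (hv : v ∈ smoothDomain (absSq D).closure) :
    (oneAddInv (absSq D).closure v, v - oneAddInv (absSq D).closure v) ∈ (absSq D).graph := by
  have h1 := hD.smoothDomain_le (hD.oneAddInv_mem hv)
  refine pair_mem_graph_iff.2 ⟨h1, ?_⟩
  obtain ⟨h2, h3⟩ := hD.isOneAddInv.1 v
  rw [← closure_apply_of_mem h1, eq_sub_iff_add_eq, add_comm]
  exact h3

theorem exists_remainder_graph {x : H} (hx : x ∈ smoothDomain (absSq D).closure) :
    ∃ r ∈ smoothDomain (absSq D).closure, (x, r) ∈ (remainder D).graph := by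
  obtain ⟨h, h'⟩ := hD.remainder_mapsTo x hx
  exact ⟨_, h', LinearPMap.mem_graph _ ⟨x, h⟩⟩

/-- `D (1 + ⟨D⟩ ^ 2)⁻¹` and `D† (1 + ⟨D⟩ ^ 2)⁻¹` are contractions. -/
theorem norm_le_of_oneAddInv {v p q : H} (hv : v ∈ smoothDomain (absSq D).closure)
    (hp : (oneAddInv (absSq D).closure v, p) ∈ D.graph)
    (hq : (oneAddInv (absSq D).closure v, q) ∈ D†.graph) : ‖p‖ ≤ ‖v‖ ∧ ‖q‖ ≤ ‖v‖ := by
  have h1 := absSq_inner hD.dense_domain (hD.absSq_oneAddInv_graph hv) hp hq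
  have h2 := re_inner_le_norm (𝕜 := ℂ) (oneAddInv (absSq D).closure v) v
  rw [inner_sub_right, Complex.sub_re] at h1
  have h3 : (⟪oneAddInv (absSq D).closure v, oneAddInv (absSq D).closure v⟫_ℂ).re =
    ‖oneAddInv (absSq D).closure v‖ ^ 2 := inner_self_eq_norm_sq (𝕜 := ℂ) _
  change (⟪oneAddInv (absSq D).closure v, v⟫_ℂ).re ≤ _ at h2
  have h4 : ‖p‖ ^ 2 + ‖q‖ ^ 2 ≤ ‖v‖ ^ 2 := by
    nlinarith [sq_nonneg (‖v‖ - 2 * ‖oneAddInv (absSq D).closure v‖), sq_nonneg ‖v‖]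
  exact ⟨(abs_le_of_sq_le_sq' (by nlinarith [sq_nonneg ‖q‖]) (norm_nonneg v)).2,
    (abs_le_of_sq_le_sq' (by nlinarith [sq_nonneg ‖p‖]) (norm_nonneg v)).2⟩

/-- `D_E (1 + ⟨D⟩ ^ 2)^(-1/2)` is bounded. -/
theorem exists_wickRotation_oneAddInvSqrt : ∃ F : H →L[ℂ] H,
    ∀ v ∈ smoothDomain (absSq D).closure,
      (oneAddInvSqrt (absSq D).closure v, F v) ∈ (wickRotation D).graph := by
  have hmem : ∀ v ∈ smoothDomain (absSq D).closure,
      oneAddInvSqrt (absSq D).closure v ∈ (wickRotation D).domain := by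
    intro v hv
    obtain ⟨r, -, hr⟩ := hD.exists_remainder_graph (hD.oneAddInvSqrt_mem hv)
    obtain ⟨p, q, -, -, hp, hq, -⟩ := remainder_graph hr
    exact (pair_mem_graph_iff.1 (wickRotation_graph_iff.2 ⟨p, q, hp, hq, rfl⟩)).1
  obtain ⟨F, hF⟩ := exists_extension_of_bound hD.dense_smoothDomain
    ((wickRotation D).toFun ∘ₗ
      ((oneAddInvSqrt (absSq D).closure : H →ₗ[ℂ] H).restrict hmem)) (Real.sqrt 2) (fun v => by
      obtain ⟨v, hv⟩ := v
      have hg := LinearPMap.mem_graph (wickRotation D) ⟨_, hmem v hv⟩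
      change ‖wickRotation D ⟨oneAddInvSqrt (absSq D).closure v, hmem v hv⟩‖ ≤ √2 * ‖v‖
      obtain ⟨p, q, hp, hq, -⟩ := wickRotation_graph_iff.1 hg
      -- Put `v = W u`; then `⟪W v, N W v⟫ ≤ ⟪W v, u⟫ = ‖v‖ ^ 2`.
      obtain ⟨u, hu, huv⟩ : ∃ u ∈ smoothDomain (absSq D).closure,
          oneAddInv (absSq D).closure u = oneAddInvSqrt (absSq D).closure v := by
        have h1 := hD.oneAddInvSqrt_mem hv
        rw [hD.isOneAddInv.smoothDomain_eq] at h1 ⊢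
        exact exists_preimage_mem_rangePowers hD.isOneAddInv.injective h1
      have huv' : oneAddInvSqrt (absSq D).closure u = v := hD.isOneAddInvSqrt.injective huv
      have h1 := hD.absSq_oneAddInv_graph hu
      rw [huv] at h1
      have h2 := absSq_inner hD.dense_domain h1 hp hq
      have h3 : ⟪oneAddInvSqrt (absSq D).closure v, u⟫_ℂ = ⟪v, v⟫_ℂ := by
        rw [← ContinuousLinearMap.adjoint_inner_right, hD.adjoint_oneAddInvSqrt, huv']
      have h4 : (⟪v, v⟫_ℂ).re = ‖v‖ ^ 2 := inner_self_eq_norm_sq (𝕜 := ℂ) _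
      have h5 : 0 ≤ (⟪oneAddInvSqrt (absSq D).closure v, oneAddInvSqrt (absSq D).closure v⟫_ℂ).re :=
        inner_self_nonneg (𝕜 := ℂ)
      rw [inner_sub_right, Complex.sub_re, h3, h4] at h2
      have h6 := wickRotation_norm_sq_le hg hp hq
      refine abs_le_of_sq_le_sq' ?_ (by positivity) |>.2
      rw [mul_pow, Real.sq_sqrt (by norm_num)]
      linarith)
  exact ⟨F, fun v hv => pair_mem_graph_iff.2 ⟨hmem v hv, (hF ⟨v, hv⟩).symm⟩⟩

/-- The condition `[⟨D⟩ ^ 2, R_D] ∈ OP ^ 2`, multiplied from both sides by `P = (1 + ⟨D⟩ ^ 2)⁻¹`: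
on smooth vectors `R P = P R + B P`, where `B` preserves the range of `P`. -/
theorem exists_commutator : ∃ B C : H →L[ℂ] H,
    (∀ u, B (oneAddInv (absSq D).closure u) = oneAddInv (absSq D).closure (C u)) ∧
    ∀ v ∈ smoothDomain (absSq D).closure, ∀ r s,
      (v, r) ∈ (remainder D).graph → (oneAddInv (absSq D).closure v, s) ∈ (remainder D).graph →
      s = oneAddInv (absSq D).closure r + B (oneAddInv (absSq D).closure v) := by
  obtain ⟨B, hB, hX⟩ := hD.commutator_remainder
  obtain ⟨C, hC⟩ := hD.isOneAddInvSqrt.exists_comp_eq_of_mem_domDelta (Set.mem_iInter.1 hB 2)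
  refine ⟨B, C, hC, fun v hv r s hr hs => ?_⟩
  set P := oneAddInv (absSq D).closure
  obtain ⟨⟨hx₁, hx₂⟩, hBx, hXB⟩ := hX _ (hD.oneAddInv_mem hv)
  have h1 := hD.isOneAddInvSqrt.apply_of_mem_powOp_two (LinearPMap.mem_graph _ ⟨_, hBx⟩)
  rw [← hXB] at h1
  change P (mulOp (absSq D) (remainder D) ⟨P v, hx₁⟩ -
    mulOp (remainder D) (absSq D) ⟨P v, hx₂⟩) = B (P v) at h1
  obtain ⟨s', hs', h2⟩ := mulOp_graph.1 (LinearPMap.mem_graph _ ⟨_, hx₁⟩)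
  obtain ⟨t, ht, h3⟩ := mulOp_graph.1 (LinearPMap.mem_graph _ ⟨_, hx₂⟩)
  obtain rfl := graph_unique hs hs'
  obtain rfl := graph_unique (hD.absSq_oneAddInv_graph hv) ht
  rw [← graph_unique ((remainder D).graph.sub_mem hr hs) h3] at h1
  obtain ⟨u, hu, h4⟩ := hD.isOneAddInv.graph_iff.1
    (LinearPMap.le_graph_of_le (LinearPMap.le_closure _) h2)
  rw [← h4] at h1
  change P (u - P u - (r - s)) = B (P v) at h1
  rw [map_sub, map_sub, map_sub, hu] at h1
  rw [← h1]
  abel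

/-- The range of `⟨D⟩ ^ 2 + R_D - i κ` on smooth vectors is dense if the real number
`κ` is large. -/
theorem exists_range_dense : ∃ K : ℝ, ∀ κ : ℝ, K < |κ| → ∀ ψ : H,
    (∀ x ∈ smoothDomain (absSq D).closure, ∀ a r, (x, a) ∈ (absSq D).graph →
      (x, r) ∈ (remainder D).graph → ⟪a + r - (κ * Complex.I) • x, ψ⟫_ℂ = 0) → ψ = 0 := by
  obtain ⟨B, C, hC, hB⟩ := hD.exists_commutator
  have hle : smoothDomain (absSq D).closure ≤ (remainder D).domain :=
    fun x hx => (hD.remainder_mapsTo x hx).1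
  have hg : ∀ x (hx : x ∈ smoothDomain (absSq D).closure),
      (x, remainder D ⟨x, hle hx⟩) ∈ (remainder D).graph :=
    fun x hx => LinearPMap.mem_graph _ (⟨x, hle hx⟩ : (remainder D).domain)
  refine ⟨‖C‖, fun κ hκ ψ hψ => ?_⟩
  refine eq_zero_of_commutator hD.adjoint_oneAddInv hD.isOneAddInv.injective hD.dense_smoothDomain
    (fun v hv => hD.oneAddInv_mem hv) ((remainder D).toFun ∘ₗ Submodule.inclusion hle)
    (fun x y => remainder_symm hD.dense_domain (hg x x.2) (hg y y.2)) zero_le_one (fun v u => ?_)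
    (fun v => hB v v.2 _ _ (hg v v.2) (hg _ (hD.oneAddInv_mem v.2))) hC hκ fun v => ?_
  · change ‖⟪remainder D ⟨oneAddInv (absSq D).closure v, hle (hD.oneAddInv_mem v.2)⟩,
      oneAddInv (absSq D).closure u⟫_ℂ‖ ≤ _
    have h1 := hg _ (hD.oneAddInv_mem v.2)
    obtain ⟨p, q, -, -, hp, hq, -⟩ := remainder_graph h1
    obtain ⟨p', q', -, -, hp', hq', -⟩ := remainder_graph (hg _ (hD.oneAddInv_mem u.2))
    rw [remainder_inner hD.dense_domain h1 hp hq hp' hq', norm_mul]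
    obtain ⟨h2, h3⟩ := hD.norm_le_of_oneAddInv v.2 hp hq
    obtain ⟨h4, h5⟩ := hD.norm_le_of_oneAddInv u.2 hp' hq'
    have h6 : ‖-(Complex.I / 2)‖ = 1 / 2 := by simp
    have h7 := norm_sub_le (⟪p, q'⟫_ℂ) (⟪q, p'⟫_ℂ)
    have h8 : ‖⟪p, q'⟫_ℂ‖ ≤ ‖(v : H)‖ * ‖(u : H)‖ :=
      (norm_inner_le_norm _ _).trans (mul_le_mul h2 h5 (norm_nonneg _) (norm_nonneg _))
    have h9 : ‖⟪q, p'⟫_ℂ‖ ≤ ‖(v : H)‖ * ‖(u : H)‖ :=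
      (norm_inner_le_norm _ _).trans (mul_le_mul h3 h4 (norm_nonneg _) (norm_nonneg _))
    rw [h6, one_mul]
    linarith
  · exact hψ _ (hD.oneAddInv_mem v.2) _ _ (hD.absSq_oneAddInv_graph v.2)
      (hg _ (hD.oneAddInv_mem v.2))

theorem dense_wickRotation_domain : Dense ((wickRotation D).domain : Set H) := by
  refine hD.dense_smoothDomain.mono fun x hx => ?_
  obtain ⟨r, -, hr⟩ := hD.exists_remainder_graph hx
  obtain ⟨p, q, -, -, hp, hq, -⟩ := remainder_graph hr
  exact (pair_mem_graph_iff.1 (wickRotation_graph_iff.2 ⟨p, q, hp, hq, rfl⟩)).1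

theorem wickRotation_isEssentiallySelfAdjoint : IsEssentiallySelfAdjoint (wickRotation D) := by
  obtain ⟨K, hK⟩ := hD.exists_range_dense
  -- `c ^ 2 = 2 i t ^ 2` and `(conj c) ^ 2 = - 2 i t ^ 2`, both far out on the imaginary axis.
  let t : ℝ := |K| + 1
  let c : ℂ := t + t * Complex.I
  have ht : 1 ≤ t := le_add_of_nonneg_left (abs_nonneg K)
  have hKt : K < 2 * t ^ 2 := by nlinarith [le_abs_self K]
  have key : ∀ (c : ℂ) (κ : ℝ), c * c = κ * Complex.I → K < |κ| → ∀ ψ : H,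
      (∀ x : (wickRotation D).domain, ⟪wickRotation D x - c • (x : H), ψ⟫_ℂ = 0) → ψ = 0 := by
    intro c κ hc hκ ψ hψ
    refine hK κ hκ ψ fun x hx a r ha hr => ?_
    obtain ⟨y, hy⟩ := exists_wickRotation_sub_sq_graph ha hr c
    obtain ⟨hy, hy'⟩ := pair_mem_graph_iff.1 hy
    have h1 := hψ ⟨y, hy⟩
    rwa [hy', add_sub_cancel_right, hc] at h1
  have habs : |2 * t ^ 2| = 2 * t ^ 2 := abs_of_nonneg (by positivity)
  refine isEssentiallySelfAdjoint_of_range hD.dense_wickRotation_domain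
    (wickRotation_isFormalAdjoint hD.dense_domain) (c := c) ?_
    (key c (2 * t ^ 2) ?_ (by rwa [habs])) (key _ (-(2 * t ^ 2)) ?_ (by rwa [abs_neg, habs]))
  · simp only [c, Complex.add_im, Complex.mul_im, Complex.ofReal_im, Complex.ofReal_re,
      Complex.I_im, Complex.I_re]
    linarith
  · simp only [c]
    push_cast
    linear_combination (t : ℂ) ^ 2 * Complex.I_sq
  · simp only [c, map_add, map_mul, Complex.conj_ofReal, Complex.conj_I]
    push_cast
    linear_combination (t : ℂ) ^ 2 * Complex.I_sq

end IsPseudoRiemannianSpectralTriple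

/-! ### Bounded commutators and compact resolvent of the Wick rotation -/

theorem IsBoundedCommutator.wickRotation {D : H →ₗ.[ℂ] H} {a c c' : H →L[ℂ] H}
    (h : IsBoundedCommutator D a c) (h' : IsBoundedCommutator D† a c') :
    IsBoundedCommutator (wickRotation D) a
      (((1 + Complex.I) / 2) • c + ((1 - Complex.I) / 2) • c') := by
  intro x
  obtain ⟨p, q, hp, hq, hx⟩ := wickRotation_graph_iff.1 (LinearPMap.mem_graph _ x)
  obtain ⟨h1, h2⟩ := pair_mem_graph_iff.1
    (wickRotation_graph_iff.2 ⟨_, _, h.graph_mem hp, h'.graph_mem hq, rfl⟩)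
  refine ⟨h1, ?_⟩
  rw [h2, hx, map_add, map_smul, map_smul]
  change _ = ((1 + Complex.I) / 2) • c x + ((1 - Complex.I) / 2) • c' x
  module

theorem inner_eq_of_isSelfAdjoint {T : H →ₗ.[ℂ] H} (hT : IsSelfAdjoint T) {x x' y y' : H}
    (h : (x, y) ∈ T.graph) (h' : (x', y') ∈ T.graph) : ⟪y, x'⟫_ℂ = ⟪x, y'⟫_ℂ := by
  obtain ⟨hx, rfl⟩ := pair_mem_graph_iff.1 h
  obtain ⟨hx', rfl⟩ := pair_mem_graph_iff.1 h'
  exact isFormalAdjoint_self hT ⟨x, hx⟩ ⟨x', hx'⟩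

/-- For self-adjoint `T` and `G = (1 + T ^ 2)⁻¹` the operator `T G` is bounded. -/
theorem exists_bounded_comp_oneAddInv {T : H →ₗ.[ℂ] H} (hT : IsSelfAdjoint T) {G : H →L[ℂ] H}
    (hG : IsOneAddInv (mulOp T T) G) :
    ∃ S : H →L[ℂ] H, ∀ y, (G y, S y) ∈ T.graph ∧ (S y, y - G y) ∈ T.graph := by
  have h1 : ∀ y, ∃ z, (G y, z) ∈ T.graph ∧ (z, y - G y) ∈ T.graph := fun y =>
    mulOp_graph.1 (hG.graph_iff.2 ⟨y, rfl, rfl⟩)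
  have hmem : ∀ y, G y ∈ T.domain := fun y => (pair_mem_graph_iff.1 (h1 y).choose_spec.1).1
  let S₀ : H →ₗ[ℂ] H := T.toFun ∘ₗ (G : H →ₗ[ℂ] H).codRestrict T.domain hmem
  have hS₀ : ∀ y, (G y, S₀ y) ∈ T.graph ∧ (S₀ y, y - G y) ∈ T.graph := by
    intro y
    obtain ⟨z, hz, hz'⟩ := h1 y
    have h2 : (G y, S₀ y) ∈ T.graph := LinearPMap.mem_graph T ⟨G y, hmem y⟩
    rw [graph_unique hz h2] at hz'
    exact ⟨h2, hz'⟩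
  refine ⟨S₀.mkContinuous 1 fun y => ?_, hS₀⟩
  obtain ⟨h2, h3⟩ := hS₀ y
  have h4 := congrArg Complex.re (inner_eq_of_isSelfAdjoint hT h2 h3)
  have h5 : (⟪S₀ y, S₀ y⟫_ℂ).re = ‖S₀ y‖ ^ 2 := inner_self_eq_norm_sq (𝕜 := ℂ) _
  have h6 : (⟪G y, G y⟫_ℂ).re = ‖G y‖ ^ 2 := inner_self_eq_norm_sq (𝕜 := ℂ) _
  have h7 : (⟪G y, y⟫_ℂ).re ≤ ‖G y‖ * ‖y‖ := re_inner_le_norm (𝕜 := ℂ) _ _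
  rw [inner_sub_right, Complex.sub_re, h5, h6] at h4
  rw [one_mul]
  exact (abs_le_of_sq_le_sq' (by nlinarith [sq_nonneg (‖y‖ - 2 * ‖G y‖), sq_nonneg ‖y‖])
    (norm_nonneg y)).2

namespace IsPseudoRiemannianSpectralTriple

variable {A : Type*} [NonUnitalRing A] [StarRing A] [Module ℂ A]
  {π : A →⋆ₙₐ[ℂ] (H →L[ℂ] H)} {D : H →ₗ.[ℂ] H} (hD : IsPseudoRiemannianSpectralTriple π D)
include hD

theorem exists_isBoundedCommutator_closure (a : A) :
    ∃ c : H →L[ℂ] H, IsBoundedCommutator (wickRotation D).closure (π a) c := by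
  obtain ⟨c, hc⟩ := hD.bounded_commutator a
  obtain ⟨c', hc'⟩ := hD.bounded_commutator_adjoint a
  exact ⟨_, (hc.wickRotation hc').closure hD.wickRotation_isEssentiallySelfAdjoint.1⟩

/-- The resolvent identity behind the compactness of the resolvent. Put `P = (1 + ⟨D⟩ ^ 2)⁻¹`,
`W = P ^ (1/2)`, `G = (1 + D_E ^ 2)⁻¹`, and let `K` be the compact extension of `a† R_D P`. Since
`1 + D_E ^ 2 = P⁻¹ + R_D`, commuting `a` past `1 + D_E ^ 2` in `P (1 + D_E ^ 2) a G` gives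
`a G = P a - K† G + W F† c G - P c'† S` with bounded `F`, `c`, `c'`, `S`. -/
theorem exists_comp_oneAddInv_eq (a : A) {G : H →L[ℂ] H}
    (hG : IsOneAddInv (mulOp (wickRotation D).closure (wickRotation D).closure) G) :
    ∃ K X Y : H →L[ℂ] H, IsCompactOperator K ∧
      π a ∘L G = K + oneAddInv (absSq D).closure ∘L X + oneAddInvSqrt (absSq D).closure ∘L Y := by
  have hE := hD.wickRotation_isEssentiallySelfAdjoint.2
  obtain ⟨S, hS⟩ := exists_bounded_comp_oneAddInv hE hG
  obtain ⟨F, hF⟩ := hD.exists_wickRotation_oneAddInvSqrt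
  obtain ⟨c, hc⟩ := hD.exists_isBoundedCommutator_closure a
  obtain ⟨c', hc'⟩ := hD.exists_isBoundedCommutator_closure (star a)
  obtain ⟨K, hK, hKR⟩ := hD.compact_remainder (star a)
  have hstar : π (star a) = (π a).adjoint := map_star π a
  rw [hstar] at hc' hKR
  refine ⟨-K.adjoint ∘L G, π a - c'.adjoint ∘L S, F.adjoint ∘L c ∘L G,
    (isCompactOperator_adjoint hK).neg.comp_clm G, ?_⟩
  ext y
  refine hD.dense_smoothDomain.eq_of_inner_right ℂ fun v hv => ?_
  set W := oneAddInvSqrt (absSq D).closure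
  set P := oneAddInv (absSq D).closure
  have hPsymm : ∀ x y : H, ⟪P x, y⟫_ℂ = ⟪x, P y⟫_ℂ := fun x y => by
    rw [← ContinuousLinearMap.adjoint_inner_right, hD.adjoint_oneAddInv]
  have hWsymm : ∀ x y : H, ⟪W x, y⟫_ℂ = ⟪x, W y⟫_ℂ := fun x y => by
    rw [← ContinuousLinearMap.adjoint_inner_right, hD.adjoint_oneAddInvSqrt]
  obtain ⟨r, -, hr⟩ := hD.exists_remainder_graph (hD.oneAddInv_mem hv)
  have hKv : K v = (π a).adjoint r := by
    obtain ⟨h1, h2⟩ := pair_mem_graph_iff.1 hr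
    rw [hKR v hv h1, h2]
  have hle := LinearPMap.le_graph_of_le (wickRotation D).le_closure
  -- `f = D_E P v` and `D_E f = (⟨D⟩ ^ 2 + R_D) P v`.
  have hf : (P v, F (W v)) ∈ (wickRotation D).graph := hF _ (hD.oneAddInvSqrt_mem hv)
  obtain ⟨f, hf₁, hf₂⟩ := wickRotation_sq (hD.absSq_oneAddInv_graph hv) hr
  obtain rfl := graph_unique hf hf₁
  have e1 := inner_eq_of_isSelfAdjoint hE (hle hf₂) (hc.graph_mem (hS y).1)
  have e2 := inner_eq_of_isSelfAdjoint hE (hc'.graph_mem (hle hf)) (hS y).2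
  have e3 : ⟪r, π a (G y)⟫_ℂ = ⟪v, K.adjoint (G y)⟫_ℂ := by
    rw [← ContinuousLinearMap.adjoint_inner_left, ← hKv, ContinuousLinearMap.adjoint_inner_right]
  change ⟪v, π a (G y)⟫_ℂ = ⟪v, -K.adjoint (G y) + P (π a y - c'.adjoint (S y)) +
    W (F.adjoint (c (G y)))⟫_ℂ
  rw [inner_add_right, inner_add_right, inner_neg_right, ← hPsymm, ← hWsymm, inner_sub_right,
    F.adjoint_inner_right, c'.adjoint_inner_right]
  rw [inner_add_left, inner_sub_left, inner_add_right, e3] at e1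
  rw [inner_add_left, inner_sub_right, ContinuousLinearMap.adjoint_inner_left,
    ContinuousLinearMap.adjoint_inner_left, ContinuousLinearMap.adjoint_inner_left] at e2
  linear_combination e1 + e2

theorem isCompactOperator_comp_oneAddInvSqrt (a : A) : IsCompactOperator
    (π a ∘L oneAddInvSqrt (mulOp (wickRotation D).closure (wickRotation D).closure)) := by
  obtain ⟨L, hL, -⟩ :=
    existsUnique_isOneAddInvSqrt_sq hD.wickRotation_isEssentiallySelfAdjoint.2
  rw [oneAddInvSqrt_eq hL]
  refine isCompactOperator_comp_of_adjoint_comp_sq hL.1.isSelfAdjoint ?_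
  obtain ⟨K, X, Y, hK, h⟩ := hD.exists_comp_oneAddInv_eq a hL.2
  rw [h]
  have hW : IsCompactOperator ((π a).adjoint ∘L oneAddInvSqrt (absSq D).closure) := by
    have h1 := hD.compact_resolvent (star a)
    rwa [map_star π a] at h1
  have h1 : (π a).adjoint ∘L (K + oneAddInv (absSq D).closure ∘L X +
        oneAddInvSqrt (absSq D).closure ∘L Y) =
      (π a).adjoint ∘L K + ((π a).adjoint ∘L oneAddInvSqrt (absSq D).closure) ∘L
          (oneAddInvSqrt (absSq D).closure ∘L X) +
        ((π a).adjoint ∘L oneAddInvSqrt (absSq D).closure) ∘L Y := by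
    simp only [ContinuousLinearMap.comp_add]
    rfl
  rw [h1]
  exact ((hK.clm_comp (π a).adjoint).add
    (hW.comp_clm (oneAddInvSqrt (absSq D).closure ∘L X))).add (hW.comp_clm Y)

theorem isSpectralTriple_closure : IsSpectralTriple π (wickRotation D).closure where
  dense_domain := hD.dense_wickRotation_domain.mono (wickRotation D).le_closure.1
  isSelfAdjoint := hD.wickRotation_isEssentiallySelfAdjoint.2
  bounded_commutator := hD.exists_isBoundedCommutator_closure
  compact_resolvent := hD.isCompactOperator_comp_oneAddInvSqrt

end IsPseudoRiemannianSpectralTriple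

end

end WickRotation

end

theorem theorem5p1 {A : Type*} [NonUnitalRing A] [StarRing A] [Module ℂ A]
    [IsScalarTower ℂ A A] [SMulCommClass ℂ A A] [StarModule ℂ A]
    {H : Type*} [NormedAddCommGroup H] [InnerProductSpace ℂ H] [CompleteSpace H]
    (π : A →⋆ₙₐ[ℂ] (H →L[ℂ] H)) (D : H →ₗ.[ℂ] H)
    (hD : WickRotation.IsPseudoRiemannianSpectralTriple π D) :
    WickRotation.wickRotation D =
        (Complex.exp (Complex.I * (Real.pi : ℂ) / 4) / (Real.sqrt 2 : ℂ)) •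
          (D - Complex.I • LinearPMap.adjoint D) ∧
      WickRotation.IsEssentiallySelfAdjoint (WickRotation.wickRotation D) ∧
      WickRotation.IsSpectralTriple π (WickRotation.wickRotation D).closure := by
  exact ⟨WickRotation.wickRotation_eq, hD.wickRotation_isEssentiallySelfAdjoint,
    hD.isSpectralTriple_closure⟩
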